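/- Let $Z=(Z_t)_{t\ge 0}$ be a subordinator (a Lévy process with nondecreasing càdlàg paths) on a probability space, let $\lambda>0$ and $\sigma_0^2>0$ be constants, and let $\sigma^2=(\sigma^2_t)_{t\ge0}$ solve the Ornstein--Uhlenbeck equation $d\sigma_t^2=-\lambda\sigma_t^2\,dt+dZ_{\lambda t}$ with initial value $\sigma_0^2$. Assume that $\sigma^2$ is a gamma Ornstein--Uhlenbeck process with parameters $a,b>0$, that is, the stationary distribution of this equation is the gamma distribution with shape $a$ and rate $b$. For $T>0$ put $I_T=\int_0^T\sigma_s^2\,ds$, let $\kappa(\theta)=\ln E[e^{\theta Z_1}]$, and for $\rho\le 0$ and $N\in\mathbb N=\{1,2,\dots\}$ put $$G_N=E\left[\left(-\lambda T\kappa(\rho)\left(\tfrac12e^{-\lambda T\kappa(\rho)}+\tfrac12\right)+|\rho|Z_{\lambda T}\right)^N\right].$$ Theorem. There are polynomials $f_N(x_0,x_1,x_2)$ and $g_N(x_0,x_1,x_2,x_3,x_4)$, $N\ge1$, with non-negative real coefficients that depend only on $N$, such that, for all such processes, all parameters $\lambda,a,b,\sigma_0^2,T>0$ and all $N\ge1$,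 the random variables $I_T$ and $(I_T-E[I_T])^N$ are integrable and $$\left|E\left[(I_T-E[I_T])^N\right]\right|\le\frac{aT}{\lambda b^N}\,f_N\!\left(a,\tfrac1\lambda,T\right),$$ and, for every $\rho\le0$, the expectation defining $G_N$ exists and is finite, and $$G_N\le\frac{a\lambda T|\rho|}{b^N}\,g_N\!\left(a,\lambda,T,|\rho|,e^{-\lambda T\kappa(\rho)}\right).$$ These polynomials can be taken to be those given recursively by $f_1=0$, $g_1=\tfrac12x_4+\tfrac32$ and, for $N\ge1$, $$f_{N+1}=x_0x_2f_N+\sum_{i=1}^{N-1}\frac{i\,N!}{(N+1-i)!}\,x_0x_1^{i-1}x_2\,f_{N+1-i}+(N+1)!\,x_1^{N-1},$$ $$g_{N+1}=\left(\tfrac12x_4+\tfrac12\right)x_0x_3x_1x_2\,g_N+\sum_{i=1}^{N}\frac{i\,N!}{(N+1-i)!}\,x_0x_1x_2x_3^{i}\,g_{N+1-i}+(N+1)!\,x_3^{N}.$$ -/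

import Mathlib

open MeasureTheory ProbabilityTheory Set Filter Topology
open scoped NNReal

noncomputable section

/-- `Z` is a subordinator under `Q`: a real Lévy process (started at `0`, with independent and
stationary increments and càdlàg paths) whose paths are nondecreasing. -/
structure IsSubordinator {Ω : Type*} [MeasurableSpace Ω] (Q : Measure Ω)
    (Z : ℝ≥0 → Ω → ℝ) : Prop where
  measurable : ∀ t, Measurable (Z t)
  zero : ∀ᵐ ω ∂Q, Z 0 ω = 0
  indep_increments : HasIndepIncrements Z Q
  stationary_increments : ∀ s t : ℝ≥0,
    IdentDistrib (fun ω => Z (s + t) ω - Z s ω) (fun ω => Z t ω - Z 0 ω) Q Q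
  cadlag : ∀ᵐ ω ∂Q, ∀ t : ℝ≥0,
    ContinuousWithinAt (fun s => Z s ω) (Ici t) t ∧
      ∃ l : ℝ, Tendsto (fun s => Z s ω) (𝓝[<] t) (𝓝 l)
  monotone : ∀ᵐ ω ∂Q, Monotone (fun t => Z t ω)

/-- `Y` solves the Ornstein-Uhlenbeck equation `dY_t = -lam Y_t dt + dZ_{lam t}`, `Y_0 = y₀`,
for `t ≥ 0`. As `Z` has paths of finite variation, this is the pathwise integral equation
`Y_t = y₀ - lam ∫₀ᵗ Y_s ds + (Z_{lam t} - Z_0)`. Only the values of `Y` at times `t ≥ 0` matter. -/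
def IsOUProcess {Ω : Type*} [MeasurableSpace Ω] (Q : Measure Ω) (lam : ℝ)
    (Z : ℝ≥0 → Ω → ℝ) (y₀ : Ω → ℝ) (Y : ℝ → Ω → ℝ) : Prop :=
  ∀ᵐ ω ∂Q, ∀ t : ℝ, 0 ≤ t →
    IntervalIntegrable (fun s => Y s ω) volume 0 t ∧
      Y t ω = y₀ ω - lam * (∫ s in (0 : ℝ)..t, Y s ω) + (Z (lam * t).toNNReal ω - Z 0 ω)

/-- `D` is a stationary distribution of the Ornstein-Uhlenbeck equation driven by `Z`: on
`Ω × ℝ` with the product measure `Q ⊗ D`, the solution `Y` whose initial value is the second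
coordinate (so that it has law `D` and is independent of `Z`) has law `D` at every time. -/
def IsOUStationaryDistribution {Ω : Type*} [MeasurableSpace Ω] (Q : Measure Ω) (lam : ℝ)
    (Z : ℝ≥0 → Ω → ℝ) (D : Measure ℝ) : Prop :=
  ∃ Y : ℝ → Ω × ℝ → ℝ,
    IsOUProcess (Q.prod D) lam (fun s p => Z s p.1) (fun p => p.2) Y ∧
      ∀ t : ℝ, 0 ≤ t → (Q.prod D).map (Y t) = D

/-- `σ2` is a gamma Ornstein-Uhlenbeck variance process with mean reversion rate `lam` and
parameters `a, b`, started at the constant `σ2₀` and driven by the subordinator `Z`: the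
stationary distribution is the gamma distribution with shape `a` and rate `b`. -/
structure IsGammaOU {Ω : Type*} [MeasurableSpace Ω] (Q : Measure Ω) (lam a b σ2₀ : ℝ)
    (Z : ℝ≥0 → Ω → ℝ) (σ2 : ℝ → Ω → ℝ) : Prop where
  subordinator : IsSubordinator Q Z
  ou : IsOUProcess Q lam Z (fun _ => σ2₀) σ2
  stationary : IsOUStationaryDistribution Q lam Z (gammaMeasure a b)

/-- The integrated variance `I_T = ∫₀ᵀ σ²_s ds`. -/
def integratedVariance {Ω : Type*} (σ2 : ℝ → Ω → ℝ) (T : ℝ) (ω : Ω) : ℝ :=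
  ∫ s in (0 : ℝ)..T, σ2 s ω

/-- The cumulant generating function `κ(θ) = ln E[exp (θ Z_1)]`. -/
def kappa {Ω : Type*} [MeasurableSpace Ω] (Q : Measure Ω) (Z : ℝ≥0 → Ω → ℝ) (θ : ℝ) : ℝ :=
  cgf (Z 1) Q θ

/-- The random variable `-λTκ(ρ) (½ e^{-λTκ(ρ)} + ½) + |ρ| Z_{λT}`, which bounds the
deviation of the exponential martingale of `ρ Z` from `1` when `ρ ≤ 0`. -/
def boundVariable {Ω : Type*} [MeasurableSpace Ω] (Q : Measure Ω) (lam : ℝ)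
    (Z : ℝ≥0 → Ω → ℝ) (ρ T : ℝ) (ω : Ω) : ℝ :=
  -(lam * T * kappa Q Z ρ) * (1 / 2 * Real.exp (-(lam * T * kappa Q Z ρ)) + 1 / 2)
    + |ρ| * Z (lam * T).toNNReal ω

/-- `G_N`, the `N`-th moment of `boundVariable`. -/
def momentG {Ω : Type*} [MeasurableSpace Ω] (Q : Measure Ω) (lam : ℝ)
    (Z : ℝ≥0 → Ω → ℝ) (ρ T : ℝ) (N : ℕ) : ℝ :=
  ∫ ω, boundVariable Q lam Z ρ T ω ^ N ∂Q

/-- The recursion for the polynomials `f_N (x₀, x₁, x₂)`, to be evaluated at `(a, 1/λ, T)`. -/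
def IsMomentFamilyF (f : ℕ → MvPolynomial (Fin 3) ℝ) : Prop :=
  f 1 = 0 ∧
    ∀ N : ℕ, 1 ≤ N →
      f (N + 1) =
        MvPolynomial.X 0 * MvPolynomial.X 2 * f N
          + ∑ i ∈ Finset.Icc 1 (N - 1),
              MvPolynomial.C ((i : ℝ) * (N.factorial : ℝ) / ((N + 1 - i).factorial : ℝ))
                * MvPolynomial.X 0 * MvPolynomial.X 1 ^ (i - 1) * MvPolynomial.X 2
                * f (N + 1 - i)
          + MvPolynomial.C ((N + 1).factorial : ℝ) * MvPolynomial.X 1 ^ (N - 1)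

/-- The recursion for the polynomials `g_N (x₀, x₁, x₂, x₃, x₄)`, to be evaluated at
`(a, λ, T, |ρ|, e^{-λTκ(ρ)})`. -/
def IsMomentFamilyG (g : ℕ → MvPolynomial (Fin 5) ℝ) : Prop :=
  g 1 = MvPolynomial.C (1 / 2) * MvPolynomial.X 4 + MvPolynomial.C (3 / 2) ∧
    ∀ N : ℕ, 1 ≤ N →
      g (N + 1) =
        (MvPolynomial.C (1 / 2) * MvPolynomial.X 4 + MvPolynomial.C (1 / 2))
            * MvPolynomial.X 0 * MvPolynomial.X 3 * MvPolynomial.X 1 * MvPolynomial.X 2 * g N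
          + ∑ i ∈ Finset.Icc 1 N,
              MvPolynomial.C ((i : ℝ) * (N.factorial : ℝ) / ((N + 1 - i).factorial : ℝ))
                * MvPolynomial.X 0 * MvPolynomial.X 1 * MvPolynomial.X 2
                * MvPolynomial.X 3 ^ i * g (N + 1 - i)
          + MvPolynomial.C ((N + 1).factorial : ℝ) * MvPolynomial.X 3 ^ N

end

/-! Stationarity of the gamma law pins down the driving subordinator. A solution started at `y`
satisfies `e^{-λt}(y + U) ≤ Y_t ≤ e^{-λt} y + U`, where `U` is the increment of `Z` over `[0, λt]`.
Taking Laplace transforms under the stationary law traps the transform of `U` between two gamma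
ratios (`mgf_increment_bounds`). Cutting `[0, S]` into `n` equal steps, raising the bounds to the
power `n` and letting `n → ∞` squeezes the transform to `exp (a S x / (b - x))` for `x ≤ 0`
(`mgf_subordinator`): `Z` is compound Poisson with exponential jumps.

Variation of constants writes `I_T` as a constant plus `∫₀ᵀ e^{-λ(T-s)} (Z_{λs} - Z_0) ds`, the
limit of Riemann-Stieltjes sums `ouSum`. By independence of increments these sums have explicit
Laplace transforms, with cumulants of order `k` between `0` and `aλT k! / (λb)^k`. The variable
defining `G_N` is almost surely a constant plus `|ρ|` times a single increment, so its cumulants are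
explicit too.

Moments follow from cumulants by `m_{N+1} = ∑ C(N,i) κ_{i+1} m_{N-i}` (`moment_succ_of_mgf_eq`). The
polynomials `f_N` and `g_N` satisfy recursions of the same shape, so induction compares the two
(`abs_centred_moment_le`, `moment_le`). For `I_T` the bound is uniform in the partition and passes
to the limit by dominated convergence, with the total increment `U / λ` controlling all sums. -/

/-! ### Cumulants and exponentially tilted moments -/

section Moments

variable {Ω ι : Type*} [MeasurableSpace Ω] {Q : Measure Ω} {V : Ω → ℝ}

/-- The derivative of order `i + 1` at `t` of the cumulant generating function
`t ↦ d t + ∑ j, c j * (t w j / (b - t w j))` of a shifted weighted sum of independent compound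
Poisson variables with exponential jumps. -/
noncomputable def cumulantDeriv (b d : ℝ) (s : Finset ι) (c w : ι → ℝ) (i : ℕ) (t : ℝ) : ℝ :=
  (if i = 0 then d else 0)
    + ∑ j ∈ s, c j * (((i + 1).factorial : ℝ) * b * w j ^ (i + 1) / (b - t * w j) ^ (i + 2))

lemma hasDerivAt_cgf_formula {b d t : ℝ} {s : Finset ι} {c w : ι → ℝ}
    (h : ∀ j ∈ s, b - t * w j ≠ 0) :
    HasDerivAt (fun t => d * t + ∑ j ∈ s, c j * (t * w j / (b - t * w j)))
      (cumulantDeriv b d s c w 0 t) t := by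
  have hd : HasDerivAt (fun t : ℝ => d * t) d t := by
    simpa using (hasDerivAt_id t).const_mul d
  refine hd.add ?_
  refine HasDerivAt.fun_sum fun j hj => ?_
  refine HasDerivAt.const_mul _ ?_
  have h1 : HasDerivAt (fun t : ℝ => t * w j) (w j) t := by
    simpa using (hasDerivAt_id t).mul_const (w j)
  refine (h1.div (h1.const_sub b) (h j hj)).congr_deriv ?_
  have := h j hj
  simp only [zero_add, Nat.factorial_one, Nat.cast_one, one_mul, pow_one]
  field_simp
  ring

lemma hasDerivAt_cumulantDeriv {b d t : ℝ} {s : Finset ι} {c w : ι → ℝ}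
    (h : ∀ j ∈ s, b - t * w j ≠ 0) (i : ℕ) :
    HasDerivAt (cumulantDeriv b d s c w i) (cumulantDeriv b d s c w (i + 1) t) t := by
  unfold cumulantDeriv
  simp only [Nat.add_eq_zero_iff, one_ne_zero, and_false, if_false]
  refine HasDerivAt.const_add _ ?_ |>.congr_deriv (zero_add _).symm
  refine HasDerivAt.fun_sum fun j hj => ?_
  refine HasDerivAt.const_mul _ ?_
  have h1 : HasDerivAt (fun t : ℝ => b - t * w j) (-w j) t := by
    simpa using ((hasDerivAt_id t).mul_const (w j)).const_sub b
  have hne := h j hj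
  refine ((hasDerivAt_const t (((i + 1).factorial : ℝ) * b * w j ^ (i + 1))).div
    (h1.pow (i + 2)) (pow_ne_zero _ hne)).congr_deriv ?_
  rw [Nat.factorial_succ (i + 1)]
  push_cast
  simp only [Pi.pow_apply]
  field_simp
  ring

lemma contDiffAt_cumulantDeriv {b d t : ℝ} {s : Finset ι} {c w : ι → ℝ}
    (h : ∀ j ∈ s, b - t * w j ≠ 0) (i : ℕ) {n : WithTop ℕ∞} :
    ContDiffAt ℝ n (cumulantDeriv b d s c w i) t := by
  unfold cumulantDeriv
  refine contDiffAt_const.add (ContDiffAt.sum fun j hj => contDiffAt_const.mul ?_)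
  exact contDiffAt_const.div (by fun_prop) (pow_ne_zero _ (h j hj))

lemma iteratedDeriv_cumulantDeriv {b d t : ℝ} {s : Finset ι} {c w : ι → ℝ}
    (hb : 0 < b) (hw : ∀ j ∈ s, 0 ≤ w j) (ht : t < 0) (i : ℕ) :
    iteratedDeriv i (cumulantDeriv b d s c w 0) t = cumulantDeriv b d s c w i t := by
  induction i generalizing t with
  | zero => simp
  | succ i ih =>
    rw [iteratedDeriv_succ]
    have : iteratedDeriv i (cumulantDeriv b d s c w 0) =ᶠ[𝓝 t] cumulantDeriv b d s c w i := by
      filter_upwards [Iio_mem_nhds ht] with x hx using ih hx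
    rw [this.deriv_eq]
    refine (hasDerivAt_cumulantDeriv (fun j hj => ?_) i).deriv
    nlinarith [hw j hj]

lemma tendsto_cumulantDeriv {b d : ℝ} {s : Finset ι} {c w : ι → ℝ} (hb : 0 < b) (i : ℕ) :
    Tendsto (cumulantDeriv b d s c w i) (𝓝[<] 0) (𝓝 (cumulantDeriv b d s c w i 0)) := by
  have : ContDiffAt ℝ 1 (cumulantDeriv b d s c w i) 0 :=
    contDiffAt_cumulantDeriv (fun j _ => by simpa using hb.ne') i
  exact this.continuousAt.tendsto.mono_left nhdsWithin_le_nhds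

/-- The recursion for the exponentially tilted moments in terms of the cumulants. -/
lemma tilted_moment_succ {b d t : ℝ} {s : Finset ι} {c w : ι → ℝ}
    (hb : 0 < b) (hw : ∀ j ∈ s, 0 ≤ w j)
    (hint : ∀ t < 0, Integrable (fun ω => Real.exp (t * V ω)) Q)
    (hmgf : ∀ t < 0, mgf V Q t
      = Real.exp (d * t + ∑ j ∈ s, c j * (t * w j / (b - t * w j))))
    (ht : t < 0) (N : ℕ) :
    ∫ ω, V ω ^ (N + 1) * Real.exp (t * V ω) ∂Q
      = ∑ i ∈ Finset.range (N + 1), (N.choose i : ℝ) * cumulantDeriv b d s c w i t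
          * ∫ ω, V ω ^ (N - i) * Real.exp (t * V ω) ∂Q := by
  have hmem : ∀ x < 0, x ∈ interior (integrableExpSet V Q) := fun x hx =>
    mem_interior.2 ⟨Iio 0, fun y hy => hint y hy, isOpen_Iio, hx⟩
  have hne : ∀ x < 0, ∀ j ∈ s, b - x * w j ≠ 0 := fun x hx j hj => by nlinarith [hw j hj]
  -- For `M = exp K` one has `M' = K' M`; the `N`-th derivative of this identity, expanded by
  -- Leibniz, is the recursion. It is needed on a neighbourhood of `t` to be differentiated.
  have hderiv : deriv (mgf V Q) =ᶠ[𝓝 t] cumulantDeriv b d s c w 0 * mgf V Q := by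
    filter_upwards [Iio_mem_nhds ht] with x hx
    have hev : mgf V Q =ᶠ[𝓝 x]
        fun t => Real.exp (d * t + ∑ j ∈ s, c j * (t * w j / (b - t * w j))) := by
      filter_upwards [Iio_mem_nhds hx] with y hy using hmgf y hy
    rw [hev.deriv_eq, (hasDerivAt_cgf_formula (hne x hx)).exp.deriv, Pi.mul_apply, hmgf x hx,
      mul_comm]
  rw [← iteratedDeriv_mgf (hmem t ht), iteratedDeriv_succ', hderiv.iteratedDeriv_eq,
    iteratedDeriv_mul (contDiffAt_cumulantDeriv (hne t ht) 0) (analyticAt_mgf (hmem t ht)).contDiffAt]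
  refine Finset.sum_congr rfl fun i _ => ?_
  rw [iteratedDeriv_cumulantDeriv hb hw ht, iteratedDeriv_mgf (hmem t ht)]

end Moments

/-! ### Existence of moments and the limit of the tilt to zero -/

section MomentLimits

variable {Ω ι : Type*} [MeasurableSpace Ω] {Q : Measure Ω} {V : Ω → ℝ}

/-- Fatou's lemma; it turns uniform bounds on tilted moments into finiteness of untilted ones. -/
lemma integrable_of_tendsto_of_integral_le {F : ℕ → Ω → ℝ} {f : Ω → ℝ} {B : ℝ}
    (hF : ∀ n, Integrable (F n) Q) (hF0 : ∀ n, 0 ≤ᵐ[Q] F n) (hB : ∀ n, ∫ ω, F n ω ∂Q ≤ B)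
    (hlim : ∀ᵐ ω ∂Q, Tendsto (fun n => F n ω) atTop (𝓝 (f ω))) : Integrable f Q := by
  refine ⟨aestronglyMeasurable_of_tendsto_ae _ (fun n => (hF n).aestronglyMeasurable) hlim, ?_⟩
  have h1 : ∫⁻ ω, ‖f ω‖ₑ ∂Q ≤ liminf (fun n => ∫⁻ ω, ‖F n ω‖ₑ ∂Q) atTop := by
    rw [lintegral_congr_ae (g := fun ω => liminf (fun n => ‖F n ω‖ₑ) atTop)]
    · exact lintegral_liminf_le' fun n => (hF n).aestronglyMeasurable.aemeasurable.enorm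
    · filter_upwards [hlim] with ω hω using hω.enorm.liminf_eq.symm
  have h2 : ∀ n, ∫⁻ ω, ‖F n ω‖ₑ ∂Q ≤ ENNReal.ofReal B := fun n => by
    rw [lintegral_congr_ae (g := fun ω => ENNReal.ofReal (F n ω)),
      ← ofReal_integral_eq_lintegral_ofReal (hF n) (hF0 n)]
    · exact ENNReal.ofReal_le_ofReal (hB n)
    · filter_upwards [hF0 n] with ω hω using Real.enorm_of_nonneg hω
  refine (h1.trans ?_).trans_lt (ENNReal.ofReal_lt_top (r := B))
  exact liminf_le_of_frequently_le' (Frequently.of_forall h2)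

lemma integrable_exp_mul_of_bddBelow [IsFiniteMeasure Q] {D t : ℝ} (hV : AEMeasurable V Q)
    (hD : ∀ᵐ ω ∂Q, -D ≤ V ω) (ht : t < 0) : Integrable (fun ω => Real.exp (t * V ω)) Q := by
  refine Integrable.of_bound (hV.const_mul t).exp.aestronglyMeasurable (Real.exp (t * -D)) ?_
  filter_upwards [hD] with ω hω
  rw [Real.norm_eq_abs, Real.abs_exp]
  exact Real.exp_le_exp.2 (mul_le_mul_of_nonpos_left hω ht.le)

lemma mem_interior_integrableExpSet_of_bddBelow [IsFiniteMeasure Q] {D t : ℝ}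
    (hV : AEMeasurable V Q) (hD : ∀ᵐ ω ∂Q, -D ≤ V ω) (ht : t < 0) :
    t ∈ interior (integrableExpSet V Q) :=
  mem_interior.2
    ⟨Iio 0, fun _ hy => integrable_exp_mul_of_bddBelow hV hD hy, isOpen_Iio, ht⟩

lemma cumulantDeriv_zero_eq {b d : ℝ} {s : Finset ι} {c w : ι → ℝ} (hb : 0 < b) (i : ℕ) :
    cumulantDeriv b d s c w i 0 = (if i = 0 then d else 0)
      + ∑ j ∈ s, c j * (((i + 1).factorial : ℝ) * w j ^ (i + 1) / b ^ (i + 1)) := by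
  unfold cumulantDeriv
  congr 1
  refine Finset.sum_congr rfl fun j _ => ?_
  rw [zero_mul, sub_zero, pow_succ b (i + 1)]
  field_simp

/-- For `t ≤ 0` each denominator satisfies `b - t w j ≥ b`. This bounds the tilted cumulants
uniformly in the tilt. -/
lemma cumulantDeriv_le {b t : ℝ} {s : Finset ι} {c w : ι → ℝ} (hb : 0 < b)
    (hc : ∀ j ∈ s, 0 ≤ c j) (hw : ∀ j ∈ s, 0 ≤ w j) (ht : t ≤ 0) (i : ℕ) :
    cumulantDeriv b 0 s c w i t ≤ cumulantDeriv b 0 s c w i 0 := by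
  unfold cumulantDeriv
  gcongr with j hj
  · exact hc j hj
  · have := hw j hj
    positivity
  · rw [zero_mul, sub_zero]
    positivity
  · rw [zero_mul, sub_zero]
    exact hb.le
  · exact hw j hj

lemma cumulantDeriv_nonneg {b t : ℝ} {s : Finset ι} {c w : ι → ℝ} (hb : 0 < b)
    (hc : ∀ j ∈ s, 0 ≤ c j) (hw : ∀ j ∈ s, 0 ≤ w j) (ht : t ≤ 0) (i : ℕ) :
    0 ≤ cumulantDeriv b 0 s c w i t := by
  unfold cumulantDeriv
  simp only [ite_self, zero_add]
  refine Finset.sum_nonneg fun j hj => ?_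
  have h1 := hc j hj
  have h2 := hw j hj
  have h3 : 0 ≤ b - t * w j := by nlinarith
  positivity

/-- A nonnegative variable with the Laplace transform of a weighted sum of independent compound
Poisson variables with exponential jumps has moments of all orders. -/
lemma integrable_pow_of_mgf_eq [IsProbabilityMeasure Q] {b : ℝ} {s : Finset ι} {c w : ι → ℝ}
    (hb : 0 < b) (hc : ∀ j ∈ s, 0 ≤ c j) (hw : ∀ j ∈ s, 0 ≤ w j)
    (hV : AEMeasurable V Q) (hV0 : ∀ᵐ ω ∂Q, 0 ≤ V ω)
    (hmgf : ∀ t < 0, mgf V Q t = Real.exp (∑ j ∈ s, c j * (t * w j / (b - t * w j))))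
    (N : ℕ) : Integrable (fun ω => V ω ^ N) Q := by
  have hD : ∀ᵐ ω ∂Q, -(0 : ℝ) ≤ V ω := by simpa using hV0
  induction N using Nat.strong_induction_on with
  | _ N ih =>
  obtain _ | N := N
  · simp
  have htilt : ∀ k : ℕ, ∀ t < 0, Integrable (fun ω => V ω ^ k * Real.exp (t * V ω)) Q :=
    fun k t ht => integrable_pow_mul_exp_of_mem_interior_integrableExpSet
      (mem_interior_integrableExpSet_of_bddBelow hV hD ht) k
  have hle : ∀ k ≤ N, ∀ t < 0,
      ∫ ω, V ω ^ k * Real.exp (t * V ω) ∂Q ≤ ∫ ω, V ω ^ k ∂Q := fun k hk t ht => by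
    refine integral_mono_ae (htilt k t ht) (ih k (by omega)) ?_
    filter_upwards [hV0] with ω hω
    have : Real.exp (t * V ω) ≤ 1 := Real.exp_le_one_iff.2 (by nlinarith)
    exact mul_le_of_le_one_right (by positivity) this
  have hneg : ∀ n : ℕ, -(1 / ((n : ℝ) + 1)) < 0 := fun n => by
    have : (0 : ℝ) < 1 / ((n : ℝ) + 1) := by positivity
    linarith
  -- The tilts `-1/(n+1)` increase to `0`. The recursion bounds the tilted moment of order `N + 1`
  -- by lower moments, finite by induction, and by the cumulants at `0`, so `B` does not depend on
  -- `n`.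
  refine integrable_of_tendsto_of_integral_le
    (F := fun n ω => V ω ^ (N + 1) * Real.exp (-(1 / ((n : ℝ) + 1)) * V ω))
    (B := ∑ i ∈ Finset.range (N + 1), (N.choose i : ℝ) * cumulantDeriv b 0 s c w i 0
          * ∫ ω, V ω ^ (N - i) ∂Q)
    (fun n => htilt _ _ (hneg n)) (fun n => ?_) (fun n => ?_) ?_
  · filter_upwards [hV0] with ω hω
    simp only [Pi.zero_apply]
    positivity
  · rw [tilted_moment_succ (d := 0) hb hw
      (fun t ht => integrable_exp_mul_of_bddBelow hV hD ht) (by simpa using hmgf) (hneg n)]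
    refine Finset.sum_le_sum fun i hi => ?_
    refine mul_le_mul (mul_le_mul_of_nonneg_left (cumulantDeriv_le hb hc hw (hneg n).le i)
      (Nat.cast_nonneg _)) (hle _ (Nat.sub_le _ _) _ (hneg n)) ?_ ?_
    · refine integral_nonneg_of_ae ?_
      filter_upwards [hV0] with ω hω
      simp only [Pi.zero_apply]
      positivity
    · exact mul_nonneg (Nat.cast_nonneg _) (cumulantDeriv_nonneg hb hc hw le_rfl i)
  · refine Eventually.of_forall fun ω => ?_
    have h1 : Tendsto (fun n : ℕ => -(1 / ((n : ℝ) + 1))) atTop (𝓝 0) := by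
      simpa using (tendsto_one_div_add_atTop_nhds_zero_nat (𝕜 := ℝ)).neg
    have h2 : Continuous fun x : ℝ => V ω ^ (N + 1) * Real.exp (x * V ω) := by fun_prop
    simpa [Function.comp_def] using (h2.tendsto 0).comp h1

/-- The recursion expressing moments through cumulants. -/
lemma moment_succ_of_mgf_eq [IsProbabilityMeasure Q] {b d D : ℝ} {s : Finset ι} {c w : ι → ℝ}
    (hb : 0 < b) (hw : ∀ j ∈ s, 0 ≤ w j)
    (hV : AEMeasurable V Q) (hD : ∀ᵐ ω ∂Q, -D ≤ V ω)
    (hint : ∀ N : ℕ, Integrable (fun ω => V ω ^ N) Q)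
    (hmgf : ∀ t < 0, mgf V Q t
      = Real.exp (d * t + ∑ j ∈ s, c j * (t * w j / (b - t * w j)))) (N : ℕ) :
    ∫ ω, V ω ^ (N + 1) ∂Q
      = ∑ i ∈ Finset.range (N + 1), (N.choose i : ℝ) * cumulantDeriv b d s c w i 0
          * ∫ ω, V ω ^ (N - i) ∂Q := by
  have hlim : ∀ k : ℕ, Tendsto (fun t : ℝ => ∫ ω, V ω ^ k * Real.exp (t * V ω) ∂Q) (𝓝[<] 0)
      (𝓝 (∫ ω, V ω ^ k ∂Q)) := fun k => by
    -- For `-1 < t < 0`, the lower bound `-D ≤ V` gives `exp (t V) ≤ exp |D|`.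
    refine tendsto_integral_filter_of_dominated_convergence
      (fun ω => |V ω ^ k| * Real.exp |D|) ?_ ?_ ((hint k).abs.mul_const _) ?_
    · exact Eventually.of_forall fun t =>
        ((hV.pow_const k).mul (hV.const_mul t).exp).aestronglyMeasurable
    · filter_upwards [Ioo_mem_nhdsLT (show (-1 : ℝ) < 0 by norm_num)] with t ht
      filter_upwards [hD] with ω hω
      rw [norm_mul, Real.norm_eq_abs, Real.norm_eq_abs, Real.abs_exp]
      gcongr
      calc t * V ω ≤ t * -D := mul_le_mul_of_nonpos_left hω ht.2.le
        _ ≤ |t * -D| := le_abs_self _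
        _ = |t| * |D| := by rw [abs_mul, abs_neg]
        _ ≤ 1 * |D| := by
          gcongr
          exact abs_le.2 ⟨ht.1.le, by linarith [ht.2]⟩
        _ = |D| := one_mul _
    · refine Eventually.of_forall fun ω => ?_
      have h2 : Continuous fun x : ℝ => V ω ^ k * Real.exp (x * V ω) := by fun_prop
      simpa using (h2.tendsto 0).mono_left nhdsWithin_le_nhds
  refine tendsto_nhds_unique (hlim (N + 1)) (Tendsto.congr' ?_ (tendsto_finsetSum _ fun i _ =>
    ((tendsto_cumulantDeriv hb i).const_mul (N.choose i : ℝ)).mul (hlim (N - i))))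
  filter_upwards [self_mem_nhdsWithin] with t ht
  exact (tilted_moment_succ hb hw (fun t ht => integrable_exp_mul_of_bddBelow hV hD ht)
    hmgf ht N).symm

end MomentLimits

/-! ### Pathwise analysis of the Ornstein-Uhlenbeck equation -/

section Path

/-- The integrated weight `∫ₛᵀ exp (-(lam (T - u))) du`. -/
noncomputable def ouWeight (lam T s : ℝ) : ℝ := (1 - Real.exp (-(lam * (T - s)))) / lam

lemma hasDerivAt_ou_exponent (lam T x : ℝ) :
    HasDerivAt (fun s : ℝ => -(lam * (T - s))) lam x := by
  simpa using (((hasDerivAt_id x).const_sub T).const_mul lam).fun_neg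

lemma integral_exp_ou {lam : ℝ} (hlam : 0 < lam) (T α β : ℝ) :
    ∫ s in α..β, Real.exp (-(lam * (T - s))) = ouWeight lam T α - ouWeight lam T β := by
  have h : ∀ x ∈ uIcc α β, HasDerivAt (fun s => Real.exp (-(lam * (T - s))) / lam)
      (Real.exp (-(lam * (T - x)))) x := fun x _ => by
    refine ((hasDerivAt_ou_exponent lam T x).exp.div_const lam).congr_deriv ?_
    field_simp
  rw [intervalIntegral.integral_eq_sub_of_hasDerivAt h
    (Continuous.intervalIntegrable (by fun_prop) _ _)]
  unfold ouWeight
  ring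

lemma ouWeight_self (lam T : ℝ) : ouWeight lam T T = 0 := by simp [ouWeight]

lemma ouWeight_nonneg {lam T s : ℝ} (hlam : 0 < lam) (hs : s ≤ T) : 0 ≤ ouWeight lam T s := by
  refine div_nonneg (sub_nonneg.2 (Real.exp_le_one_iff.2 ?_)) hlam.le
  nlinarith

lemma ouWeight_le {lam T s : ℝ} (hlam : 0 < lam) : ouWeight lam T s ≤ 1 / lam := by
  unfold ouWeight
  gcongr
  linarith [Real.exp_pos (-(lam * (T - s)))]

lemma ouWeight_sub_le {lam T α β : ℝ} (hlam : 0 < lam) (hαβ : α ≤ β) (hβ : β ≤ T) :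
    ouWeight lam T α - ouWeight lam T β ≤ β - α := by
  rw [← integral_exp_ou hlam]
  have h : ∫ s in α..β, Real.exp (-(lam * (T - s))) ≤ ∫ _ in α..β, (1 : ℝ) := by
    refine intervalIntegral.integral_mono_on hαβ
      (Continuous.intervalIntegrable (by fun_prop) _ _) (by simp) fun x hx => ?_
    refine Real.exp_le_one_iff.2 ?_
    nlinarith [hx.2]
  simpa using h

lemma intervalIntegrable_exp_ou_mul {lam T : ℝ} {z : ℝ → ℝ} (hz : Monotone z) (α β : ℝ) :
    IntervalIntegrable (fun s => Real.exp (-(lam * (T - s))) * z s) volume α β :=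
  (hz.intervalIntegrable (a := α) (b := β)).continuousOn_mul (by fun_prop)

lemma integral_exp_ou_mul_mem {lam T α β : ℝ} {z : ℝ → ℝ} (hlam : 0 < lam) (hz : Monotone z)
    (hαβ : α ≤ β) :
    z α * (ouWeight lam T α - ouWeight lam T β)
        ≤ ∫ s in α..β, Real.exp (-(lam * (T - s))) * z s ∧
      ∫ s in α..β, Real.exp (-(lam * (T - s))) * z s
        ≤ z β * (ouWeight lam T α - ouWeight lam T β) := by
  have hi := intervalIntegrable_exp_ou_mul (lam := lam) (T := T) hz α β
  have hc : ∀ c : ℝ, IntervalIntegrable (fun s => c * Real.exp (-(lam * (T - s)))) volume α β :=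
    fun c => Continuous.intervalIntegrable (by fun_prop) _ _
  rw [← integral_exp_ou hlam, ← intervalIntegral.integral_const_mul,
    ← intervalIntegral.integral_const_mul]
  constructor
  · refine intervalIntegral.integral_mono_on hαβ (hc _) hi fun x hx => ?_
    rw [mul_comm (z α)]
    exact mul_le_mul_of_nonneg_left (hz hx.1) (Real.exp_pos _).le
  · refine intervalIntegral.integral_mono_on hαβ hi (hc _) fun x hx => ?_
    rw [mul_comm (z β)]
    exact mul_le_mul_of_nonneg_left (hz hx.2) (Real.exp_pos _).le

/-- The Riemann-Stieltjes sums `∑ W (s_j) (z (s_{j+1}) - z (s_j))` approximate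
`∫₀ᵀ exp (-(lam (T - s))) z s ds`. -/
lemma abs_integral_exp_ou_mul_sub_sum_le {lam T : ℝ} {z : ℝ → ℝ} (hlam : 0 < lam) (hT : 0 ≤ T)
    (hz : Monotone z) (hz0 : z 0 = 0) {n : ℕ} (hn : n ≠ 0) :
    |(∫ s in (0 : ℝ)..T, Real.exp (-(lam * (T - s))) * z s)
      - ∑ j ∈ Finset.range n, ouWeight lam T (j * (T / n))
          * (z ((j + 1 : ℕ) * (T / n)) - z (j * (T / n)))| ≤ T / n * z T := by
  set p : ℕ → ℝ := fun j => j * (T / n) with hp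
  have hn' : (0 : ℝ) < n := by positivity
  have hpn : p n = T := by simp only [hp]; field_simp
  have hp0 : p 0 = 0 := by simp [hp]
  have hstep : ∀ j, p (j + 1) - p j = T / n := fun j => by simp only [hp]; push_cast; ring
  have hmono : Monotone p := monotone_nat_of_le_succ fun j => by
    have : 0 ≤ T / n := by positivity
    linarith [hstep j]
  -- Abel summation; the boundary terms vanish because the weight is zero at `T` and `z 0 = 0`.
  have habel : ∑ j ∈ Finset.range n, ouWeight lam T (p j) * (z (p (j + 1)) - z (p j))
      = ∑ j ∈ Finset.range n, z (p (j + 1)) * (ouWeight lam T (p j) - ouWeight lam T (p (j + 1))) := by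
    rw [← sub_eq_zero, ← Finset.sum_sub_distrib]
    have := Finset.sum_range_sub (fun j => ouWeight lam T (p j) * z (p j)) n
    rw [hpn, hp0, ouWeight_self, hz0, zero_mul, mul_zero, sub_zero] at this
    rw [← this]
    refine Finset.sum_congr rfl fun j _ => ?_
    ring
  have hsum : ∫ s in (0 : ℝ)..T, Real.exp (-(lam * (T - s))) * z s
      = ∑ j ∈ Finset.range n, ∫ s in p j..p (j + 1), Real.exp (-(lam * (T - s))) * z s := by
    rw [intervalIntegral.sum_integral_adjacent_intervals
      fun j _ => intervalIntegrable_exp_ou_mul hz _ _, hpn, hp0]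
  have hkey : ∀ j, _ := fun j =>
    integral_exp_ou_mul_mem (T := T) (z := z) hlam hz (hmono (Nat.le_succ j))
  change |_ - ∑ j ∈ Finset.range n, ouWeight lam T (p j) * (z (p (j + 1)) - z (p j))| ≤ _
  rw [habel, hsum, abs_sub_comm, abs_of_nonneg
    (sub_nonneg.2 (Finset.sum_le_sum fun j _ => (hkey j).2)), ← Finset.sum_sub_distrib]
  -- On each cell the error is at most the drop of the weight times the increment of `z`. The drop
  -- is at most the mesh `T / n`, and the increments telescope.
  calc ∑ j ∈ Finset.range n, (z (p (j + 1)) * (ouWeight lam T (p j) - ouWeight lam T (p (j + 1)))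
        - ∫ s in p j..p (j + 1), Real.exp (-(lam * (T - s))) * z s)
      ≤ ∑ j ∈ Finset.range n, T / n * (z (p (j + 1)) - z (p j)) := by
        refine Finset.sum_le_sum fun j hj => ?_
        have h1 := (hkey j).1
        have h2 := ouWeight_sub_le hlam (hmono (Nat.le_succ j))
          ((hmono (Finset.mem_range.1 hj)).trans_eq hpn)
        have h3 : 0 ≤ z (p (j + 1)) - z (p j) := sub_nonneg.2 (hz (hmono (Nat.le_succ j)))
        have h4 := hstep j
        simp only [Nat.succ_eq_add_one] at h1 h2
        rw [h4] at h2
        nlinarith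
    _ = T / n * z T := by
        rw [← Finset.mul_sum, Finset.sum_range_sub (fun j => z (p j)), hpn, hp0, hz0, sub_zero]

/-- The variation of constants formula for the integral of a solution of `Y = y₀ - lam ∫ Y + z`. -/
lemma integral_eq_of_ou {lam y₀ T : ℝ} {Y z : ℝ → ℝ} (hT : 0 ≤ T)
    (hz : Monotone z) (hzc : ∀ t, 0 ≤ t → ContinuousWithinAt z (Ioi t) t)
    (hY : ∀ t, 0 ≤ t → IntervalIntegrable Y volume 0 t ∧
      Y t = y₀ - lam * (∫ s in (0 : ℝ)..t, Y s) + z t) :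
    ∫ s in (0 : ℝ)..T, Y s = ∫ s in (0 : ℝ)..T, Real.exp (-(lam * (T - s))) * (y₀ + z s) := by
  set J : ℝ → ℝ := fun t => ∫ s in (0 : ℝ)..t, Y s with hJ
  have hJc : ContinuousOn J (Icc 0 T) := by
    have h := (hY T hT).1
    rw [intervalIntegrable_iff_integrableOn_Icc_of_le hT] at h
    have := intervalIntegral.continuousOn_primitive_interval (a := 0) (b := T) (f := Y)
      (μ := volume) (by rwa [uIcc_of_le hT])
    rwa [uIcc_of_le hT] at this
  -- The exponential is the integrating factor for `J' = y₀ - lam J + z`. Since `z` may jump, only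
  -- right derivatives are used.
  have hderiv : ∀ x ∈ Ioo 0 T, HasDerivWithinAt
      (fun t => Real.exp (-(lam * (T - t))) * J t)
      (Real.exp (-(lam * (T - x))) * (y₀ + z x)) (Ioi x) x := fun x hx => by
    have hJx : ContinuousAt J x := (hJc x ⟨hx.1.le, hx.2.le⟩).continuousAt (Icc_mem_nhds hx.1 hx.2)
    have hYc : ContinuousWithinAt Y (Ioi x) x := by
      have h1 : ContinuousWithinAt (fun t => y₀ - lam * J t + z t) (Ioi x) x :=
        ((hJx.continuousWithinAt.const_mul lam).const_sub y₀).add (hzc x hx.1.le)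
      exact h1.congr (fun t ht => (hY t (hx.1.trans ht).le).2) (hY x hx.1.le).2
    have hmeas : StronglyMeasurableAtFilter Y (𝓝[>] x) volume := by
      refine ⟨Ioc 0 T, mem_nhdsWithin_of_mem_nhds (Ioc_mem_nhds hx.1 hx.2), ?_⟩
      exact (hY T hT).1.aestronglyMeasurable
    have hJd : HasDerivWithinAt J (Y x) (Ioi x) x :=
      (intervalIntegral.integral_hasDerivWithinAt_right (s := Ici x) (t := Ioi x)
        (hY x hx.1.le).1 hmeas hYc).mono Ioi_subset_Ici_self
    refine ((hasDerivAt_ou_exponent lam T x).exp.hasDerivWithinAt.mul hJd).congr_deriv ?_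
    rw [(hY x hx.1.le).2]
    ring
  have hzi : Monotone fun s => y₀ + z s := fun _ _ h => by simpa using hz h
  have hft := intervalIntegral.integral_eq_sub_of_hasDeriv_right_of_le hT
    (f := fun t => Real.exp (-(lam * (T - t))) * J t)
    ((by fun_prop : Continuous fun t => Real.exp (-(lam * (T - t)))).continuousOn.mul hJc)
    hderiv (intervalIntegrable_exp_ou_mul hzi 0 T)
  rw [hft]
  simp [hJ]

lemma integral_eq_of_ou' {lam y₀ T : ℝ} {Y z : ℝ → ℝ} (hlam : 0 < lam) (hT : 0 ≤ T)
    (hz : Monotone z) (hzc : ∀ t, 0 ≤ t → ContinuousWithinAt z (Ioi t) t)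
    (hY : ∀ t, 0 ≤ t → IntervalIntegrable Y volume 0 t ∧
      Y t = y₀ - lam * (∫ s in (0 : ℝ)..t, Y s) + z t) :
    ∫ s in (0 : ℝ)..T, Y s = y₀ * ouWeight lam T 0
      + ∫ s in (0 : ℝ)..T, Real.exp (-(lam * (T - s))) * z s := by
  rw [integral_eq_of_ou hT hz hzc hY]
  simp_rw [mul_add]
  rw [intervalIntegral.integral_add (Continuous.intervalIntegrable (by fun_prop) _ _)
    (intervalIntegrable_exp_ou_mul hz 0 T), intervalIntegral.integral_mul_const,
    integral_exp_ou hlam, ouWeight_self, sub_zero, mul_comm]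

/-- Each increment of `z` before time `t` is discounted by a factor between `e^{-lam t}` and `1`.
This crude two-sided bound is exact to first order for small `t`, which is all that the limit over
fine partitions requires. -/
lemma ou_mem_Icc {lam y₀ t : ℝ} {Y z : ℝ → ℝ} (hlam : 0 < lam) (ht : 0 ≤ t)
    (hz : Monotone z) (hz0 : z 0 = 0) (hzc : ∀ t, 0 ≤ t → ContinuousWithinAt z (Ioi t) t)
    (hY : ∀ t, 0 ≤ t → IntervalIntegrable Y volume 0 t ∧
      Y t = y₀ - lam * (∫ s in (0 : ℝ)..t, Y s) + z t) :
    Real.exp (-(lam * t)) * (y₀ + z t) ≤ Y t ∧ Y t ≤ Real.exp (-(lam * t)) * y₀ + z t := by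
  have h := integral_exp_ou_mul_mem (T := t) hlam hz ht
  rw [(hY t ht).2, integral_eq_of_ou' hlam ht hz hzc hY]
  rw [ouWeight_self, hz0, zero_mul, sub_zero] at h
  have hW : Real.exp (-(lam * t)) = 1 - lam * ouWeight lam t 0 := by
    unfold ouWeight
    rw [sub_zero]
    field_simp
    ring
  rw [hW]
  constructor
  · nlinarith [mul_le_mul_of_nonneg_left h.2 hlam.le]
  · nlinarith [mul_nonneg hlam.le h.1]

end Path

/-! ### The moment generating function of the gamma law -/

section GammaMgf

/-- Tilting by `exp (x y)` turns the gamma density of rate `b` into a constant multiple of the one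
of rate `b - x`, whose mass is one. -/
lemma integrable_exp_mul_gammaPDFReal_and_integral_eq {a b x : ℝ} (ha : 0 < a) (hb : 0 < b)
    (hx : x < b) :
    Integrable (fun y => gammaPDFReal a b y * Real.exp (x * y)) ∧
      ∫ y, gammaPDFReal a b y * Real.exp (x * y) = (b / (b - x)) ^ a := by
  have hbx : 0 < b - x := sub_pos.2 hx
  have hG := Real.Gamma_pos_of_pos ha
  have heq : (fun y => gammaPDFReal a b y * Real.exp (x * y))
      = fun y => (b / (b - x)) ^ a * gammaPDFReal a (b - x) y := by
    funext y
    unfold gammaPDFReal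
    split_ifs
    · rw [Real.div_rpow hb.le hbx.le]
      have : Real.exp (-((b - x) * y)) = Real.exp (-(b * y)) * Real.exp (x * y) := by
        rw [← Real.exp_add]; congr 1; ring
      rw [this]
      have := (Real.rpow_pos_of_pos hbx a).ne'
      field_simp
    · simp
  have hone := lintegral_gammaPDF_eq_one ha hbx
  have h0 : 0 ≤ᵐ[volume] gammaPDFReal a (b - x) :=
    Eventually.of_forall (gammaPDFReal_nonneg ha hbx)
  have hm : AEStronglyMeasurable (gammaPDFReal a (b - x)) volume :=
    (measurable_gammaPDFReal a (b - x)).aestronglyMeasurable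
  have hi : Integrable (gammaPDFReal a (b - x)) :=
    (lintegral_ofReal_ne_top_iff_integrable hm h0).1 (by
      change ∫⁻ y, gammaPDF a (b - x) y ≠ ⊤
      simp [hone])
  have h1 : ∫ y, gammaPDFReal a (b - x) y = 1 := by
    rw [integral_eq_lintegral_of_nonneg_ae h0 hm]
    change (∫⁻ y, gammaPDF a (b - x) y).toReal = 1
    simp [hone]
  rw [heq]
  exact ⟨hi.const_mul _, by rw [integral_const_mul, h1, mul_one]⟩

lemma integrable_exp_mul_gammaMeasure {a b x : ℝ} (ha : 0 < a) (hb : 0 < b) (hx : x < b) :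
    Integrable (fun y => Real.exp (x * y)) (gammaMeasure a b) := by
  unfold gammaMeasure
  rw [integrable_withDensity_iff_integrable_smul' (by unfold gammaPDF; fun_prop)
    (Eventually.of_forall fun y => by simp [gammaPDF])]
  refine (integrable_exp_mul_gammaPDFReal_and_integral_eq ha hb hx).1.congr
    (Eventually.of_forall fun y => ?_)
  simp [gammaPDF, ENNReal.toReal_ofReal (gammaPDFReal_nonneg ha hb y)]

lemma mgf_gammaMeasure {a b x : ℝ} (ha : 0 < a) (hb : 0 < b) (hx : x < b) :
    mgf id (gammaMeasure a b) x = (b / (b - x)) ^ a := by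
  rw [← (integrable_exp_mul_gammaPDFReal_and_integral_eq ha hb hx).2]
  unfold mgf gammaMeasure
  rw [integral_withDensity_eq_integral_toReal_smul (by unfold gammaPDF; fun_prop)
    (Eventually.of_forall fun y => by simp [gammaPDF])]
  refine integral_congr_ae (Eventually.of_forall fun y => ?_)
  simp [gammaPDF, ENNReal.toReal_ofReal (gammaPDFReal_nonneg ha hb y)]

end GammaMgf

/-! ### Independent stationary increments and time-changed paths -/

section Subordinator

variable {Ω : Type*} [MeasurableSpace Ω] {Q : Measure Ω} {Z : ℝ≥0 → Ω → ℝ}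

lemma IsSubordinator.mgf_increment (hZ : IsSubordinator Q Z) (s t : ℝ≥0) (x : ℝ) :
    mgf (fun ω => Z (s + t) ω - Z s ω) Q x = mgf (fun ω => Z t ω - Z 0 ω) Q x := by
  rw [mgf_congr_identDistrib (hZ.stationary_increments s t)]

/-- The moment generating function of a weighted sum of increments over equal time steps. -/
lemma IsSubordinator.mgf_sum_increments (hZ : IsSubordinator Q Z) (h : ℝ≥0) (w : ℕ → ℝ) (n : ℕ)
    (x : ℝ) :
    mgf (fun ω => ∑ j ∈ Finset.range n, w j * (Z ((j + 1 : ℕ) * h) ω - Z (j * h) ω)) Q x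
      = ∏ j ∈ Finset.range n, mgf (fun ω => Z h ω - Z 0 ω) Q (w j * x) := by
  have hmono : Monotone fun j : ℕ => (j : ℝ≥0) * h := fun i j hij => by
    dsimp only
    gcongr
  have hind := (hZ.indep_increments.nat hmono).comp (fun j y => w j * y)
    fun j => measurable_const_mul (w j)
  have hsum := hind.mgf_sum (t := x) (fun j => by
    have h1 := hZ.measurable
    exact ((h1 _).sub (h1 _)).const_mul (w j)) (Finset.range n)
  have e1 : (∑ j ∈ Finset.range n,
      ((fun y => w j * y) ∘ fun ω => Z ((j + 1 : ℕ) * h) ω - Z (j * h) ω))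
      = fun ω => ∑ j ∈ Finset.range n, w j * (Z ((j + 1 : ℕ) * h) ω - Z (j * h) ω) := by
    funext ω
    simp
  rw [← e1, hsum]
  refine Finset.prod_congr rfl fun j _ => ?_
  have := hZ.mgf_increment (j * h) h (w j * x)
  rw [← this, ← mgf_const_mul]
  congr 1
  funext ω
  simp [add_mul]

lemma IsSubordinator.mgf_nsmul (hZ : IsSubordinator Q Z) (h : ℝ≥0) (n : ℕ) (x : ℝ) :
    mgf (fun ω => Z (n * h) ω - Z 0 ω) Q x = mgf (fun ω => Z h ω - Z 0 ω) Q x ^ n := by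
  have := hZ.mgf_sum_increments h (fun _ => 1) n x
  simp only [one_mul, Finset.prod_const, Finset.card_range] at this
  rw [← this]
  congr 1
  funext ω
  rw [Finset.sum_range_sub (fun j => Z ((j : ℕ) * h) ω)]
  simp

/-- The regularity of the time-changed path `s ↦ Z (lam s) - Z 0`. -/
lemma IsSubordinator.ae_path (hZ : IsSubordinator Q Z) {lam : ℝ} (hlam : 0 < lam) :
    ∀ᵐ ω ∂Q, Monotone (fun s : ℝ => Z (lam * s).toNNReal ω - Z 0 ω) ∧
      ∀ t, 0 ≤ t →
        ContinuousWithinAt (fun s : ℝ => Z (lam * s).toNNReal ω - Z 0 ω) (Ioi t) t := by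
  filter_upwards [hZ.cadlag, hZ.monotone] with ω hc hm
  have hmono : Monotone fun s : ℝ => (lam * s).toNNReal := fun s t hst =>
    Real.toNNReal_le_toNNReal (by gcongr)
  refine ⟨fun s t hst => sub_le_sub_right (hm (hmono hst)) _, fun t _ => ?_⟩
  have h1 : ContinuousWithinAt (fun s : ℝ => (lam * s).toNNReal) (Ioi t) t :=
    (continuous_real_toNNReal.comp (continuous_const_mul lam)).continuousWithinAt
  have h2 : ContinuousWithinAt ((fun r => Z r ω) ∘ fun s : ℝ => (lam * s).toNNReal) (Ioi t) t :=
    ContinuousWithinAt.comp (hc (lam * t).toNNReal).1 h1 fun s hs => hmono (le_of_lt hs)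
  exact h2.sub continuousWithinAt_const

end Subordinator

/-! ### Identification of the subordinator from the stationary law -/

section Stationary

variable {Ω : Type*} [MeasurableSpace Ω] {Q : Measure Ω} {Z : ℝ≥0 → Ω → ℝ}

lemma tendsto_nat_mul_one_sub_exp (S : ℝ) :
    Tendsto (fun n : ℕ => (n : ℝ) * (1 - Real.exp (-(S / n)))) atTop (𝓝 S) := by
  have h1 : HasDerivAt (fun y : ℝ => 1 - Real.exp (-(S * y))) S 0 := by
    have : HasDerivAt (fun y : ℝ => -(S * y)) (-S) 0 := by
      simpa using ((hasDerivAt_id (0 : ℝ)).const_mul S).fun_neg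
    simpa using this.exp.const_sub 1
  have h2 := h1.tendsto_slope_zero_right.comp tendsto_inv_atTop_nhdsGT_zero |>.comp
    (tendsto_natCast_atTop_atTop (R := ℝ))
  refine h2.congr fun n => ?_
  simp [div_eq_mul_inv]

/-- This is `(1 + k/n + o(1/n))^n → e^k`, raised to the power `a`. -/
lemma tendsto_rpow_gamma_ratio_pow {a k : ℝ} {u v : ℕ → ℝ}
    (hpos : ∀ n, 0 < u n / v n) (hlim : Tendsto (fun n : ℕ => (n : ℝ) * (u n / v n - 1)) atTop (𝓝 k)) :
    Tendsto (fun n : ℕ => ((u n / v n) ^ a) ^ n) atTop (𝓝 (Real.exp (a * k))) := by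
  have h1 := Real.tendsto_one_add_pow_exp_of_tendsto hlim
  have h2 := h1.rpow_const (p := a) (Or.inl (Real.exp_pos k).ne')
  rw [← Real.exp_mul, mul_comm k a] at h2
  refine h2.congr fun n => ?_
  rw [add_sub_cancel, ← Real.rpow_natCast, ← Real.rpow_natCast, ← Real.rpow_mul (hpos n).le,
    ← Real.rpow_mul (hpos n).le, mul_comm]

lemma integrable_exp_increment [IsFiniteMeasure Q] (hZ : IsSubordinator Q Z) (r : ℝ≥0) {x : ℝ}
    (hx : x < 0) : Integrable (fun ω => Real.exp (x * (Z r ω - Z 0 ω))) Q := by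
  refine integrable_exp_mul_of_bddBelow (D := 0)
    ((hZ.measurable r).sub (hZ.measurable 0)).aemeasurable ?_ hx
  filter_upwards [hZ.monotone] with ω hω
  simpa using hω (zero_le : 0 ≤ r)

/-- Over a time step, stationarity of the gamma distribution bounds the moment generating
function of the increments from both sides. -/
lemma mgf_increment_bounds [IsProbabilityMeasure Q] (hZ : IsSubordinator Q Z)
    {lam a b : ℝ} (hlam : 0 < lam) (ha : 0 < a) (hb : 0 < b)
    (hst : IsOUStationaryDistribution Q lam Z (gammaMeasure a b)) {t x : ℝ} (ht : 0 ≤ t)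
    (hx : x < 0) :
    mgf (fun ω => Z (lam * t).toNNReal ω - Z 0 ω) Q x
        ≤ ((b - x * Real.exp (-(lam * t))) / (b - x)) ^ a ∧
      ((b - x) / (b - x * Real.exp (lam * t))) ^ a
        ≤ mgf (fun ω => Z (lam * t).toNNReal ω - Z 0 ω) Q x := by
  obtain ⟨Y, hY, hlaw⟩ := hst
  have : IsProbabilityMeasure (gammaMeasure a b) := isProbabilityMeasure_gammaMeasure ha hb
  set D := gammaMeasure a b with hD
  set e := Real.exp (-(lam * t)) with he
  have he0 : 0 < e := Real.exp_pos _
  -- A map that is not a.e. measurable has pushforward zero, which cannot be the gamma probability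
  -- measure.
  have hmeas : AEMeasurable (Y t) (Q.prod D) := by
    by_contra h
    have h1 := hlaw t ht
    rw [Measure.map_of_not_aemeasurable h] at h1
    exact IsProbabilityMeasure.ne_zero D h1.symm
  have hYmgf : ∀ x < b, mgf (Y t) (Q.prod D) x = (b / (b - x)) ^ a := fun x hx => by
    rw [← mgf_id_map hmeas, hlaw t ht, mgf_gammaMeasure ha hb hx]
  have hYint : ∀ x < b, Integrable (fun p => Real.exp (x * Y t p)) (Q.prod D) := fun x hx => by
    have h1 := integrable_exp_mul_gammaMeasure ha hb hx
    rw [← hD, ← hlaw t ht] at h1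
    exact h1.comp_aemeasurable hmeas
  have hbd : ∀ᵐ p ∂(Q.prod D),
      e * (p.2 + (Z (lam * t).toNNReal p.1 - Z 0 p.1)) ≤ Y t p ∧
        Y t p ≤ e * p.2 + (Z (lam * t).toNNReal p.1 - Z 0 p.1) := by
    filter_upwards [hY, Measure.quasiMeasurePreserving_fst.ae (hZ.ae_path hlam)] with p hp hz
    exact ou_mem_Icc (Y := fun s => Y s p)
      (z := fun s : ℝ => Z (lam * s).toNNReal p.1 - Z 0 p.1) hlam ht hz.1 (by simp) hz.2 hp
  have hprod : ∀ x₁ x₂ : ℝ, ∫ p : Ω × ℝ, Real.exp (x₁ * (Z (lam * t).toNNReal p.1 - Z 0 p.1))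
      * Real.exp (x₂ * p.2) ∂(Q.prod D)
      = mgf (fun ω => Z (lam * t).toNNReal ω - Z 0 ω) Q x₁ * mgf id D x₂ := fun x₁ x₂ =>
    integral_prod_mul (fun ω => Real.exp (x₁ * (Z (lam * t).toNNReal ω - Z 0 ω)))
      (fun y => Real.exp (x₂ * y))
  have hprodi : ∀ x₁ < 0, ∀ x₂ < 0,
      Integrable (fun p : Ω × ℝ => Real.exp (x₁ * (Z (lam * t).toNNReal p.1 - Z 0 p.1))
        * Real.exp (x₂ * p.2)) (Q.prod D) := fun x₁ h₁ x₂ h₂ =>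
    (integrable_exp_increment hZ _ h₁).mul_prod
      (integrable_exp_mul_gammaMeasure ha hb (h₂.trans hb))
  constructor
  -- Upper pathwise bound: since `x < 0`, `exp (x Y_t) ≥ exp (x e y) exp (x U)`; the expectation
  -- factorises, and dividing by the gamma transform at `x e` gives the claim.
  · have hxe : x * e < 0 := mul_neg_of_neg_of_pos hx he0
    have hle : mgf (fun ω => Z (lam * t).toNNReal ω - Z 0 ω) Q x * mgf id D (x * e)
        ≤ mgf (Y t) (Q.prod D) x := by
      rw [← hprod]
      refine integral_mono_ae (hprodi x hx _ hxe) (hYint x (hx.trans hb)) ?_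
      filter_upwards [hbd] with p hp
      rw [← Real.exp_add]
      refine Real.exp_le_exp.2 ?_
      nlinarith [hp.2]
    have h1 : 0 < b - x * e := by linarith
    have h2 : 0 < b - x := by linarith
    rw [hYmgf x (hx.trans hb), mgf_gammaMeasure ha hb (hxe.trans hb)] at hle
    have h3 : 0 < (b / (b - x * e)) ^ a := by positivity
    rw [← le_div_iff₀ h3, ← Real.div_rpow (by positivity) (by positivity)] at hle
    have h4 : b / (b - x) / (b / (b - x * e)) = (b - x * e) / (b - x) := by field_simp
    rwa [h4] at hle
  -- Lower pathwise bound, evaluated at `x E` with `E = 1 / e` so that the discount factor cancels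
  -- and `U` is again tested at `x`.
  · have hee : Real.exp (lam * t) * e = 1 := by rw [he, ← Real.exp_add]; simp
    set E := Real.exp (lam * t) with hE
    have hE0 : 0 < E := Real.exp_pos _
    have hxE : x * E < 0 := mul_neg_of_neg_of_pos hx hE0
    have hle : mgf (Y t) (Q.prod D) (x * E)
        ≤ mgf (fun ω => Z (lam * t).toNNReal ω - Z 0 ω) Q x * mgf id D x := by
      rw [← hprod]
      refine integral_mono_ae (hYint _ (hxE.trans hb)) (hprodi x hx x hx) ?_
      filter_upwards [hbd] with p hp
      rw [← Real.exp_add]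
      refine Real.exp_le_exp.2 ?_
      have := mul_le_mul_of_nonpos_left hp.1 hxE.le
      linear_combination this + x * ((Z (lam * t).toNNReal p.1 - Z 0 p.1) + p.2) * hee
    have h1 : 0 < b - x * E := by linarith
    have h2 : 0 < b - x := by linarith
    rw [hYmgf _ (hxE.trans hb), mgf_gammaMeasure ha hb (hx.trans hb)] at hle
    have h3 : 0 < (b / (b - x)) ^ a := by positivity
    rw [← div_le_iff₀ h3, ← Real.div_rpow (by positivity) (by positivity)] at hle
    have h4 : b / (b - x * E) / (b / (b - x)) = (b - x) / (b - x * E) := by field_simp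
    rwa [h4] at hle

/-- The driving subordinator of a gamma Ornstein-Uhlenbeck process is compound Poisson with
intensity `a` and exponential jumps of rate `b`. -/
lemma mgf_subordinator [IsProbabilityMeasure Q] (hZ : IsSubordinator Q Z)
    {lam a b : ℝ} (hlam : 0 < lam) (ha : 0 < a) (hb : 0 < b)
    (hst : IsOUStationaryDistribution Q lam Z (gammaMeasure a b)) (S : ℝ≥0) {x : ℝ}
    (hx : x ≤ 0) :
    mgf (fun ω => Z S ω - Z 0 ω) Q x = Real.exp (a * (S * (x / (b - x)))) := by
  obtain rfl | hx := hx.eq_or_lt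
  · simp
  have hbx : 0 < b - x := by linarith
  have hbxp : ∀ y > 0, 0 < b - x * y := fun y hy => by nlinarith
  -- The OU time step `S / n / lam` corresponds to subordinator time `S / n`.
  have hpow : ∀ n : ℕ, n ≠ 0 → mgf (fun ω => Z S ω - Z 0 ω) Q x
      = mgf (fun ω => Z (lam * (S / n / lam)).toNNReal ω - Z 0 ω) Q x ^ n := fun n hn => by
    have e1 : (n : ℝ≥0) * (lam * (S / n / lam)).toNNReal = S := by
      have hn' : (n : ℝ) ≠ 0 := by positivity
      apply NNReal.eq
      push_cast
      rw [Real.coe_toNNReal _ (by positivity)]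
      field_simp
    rw [← hZ.mgf_nsmul, e1]
  have hnn := fun n : ℕ => mgf_increment_bounds hZ hlam ha hb hst (t := S / n / lam) (x := x)
    (by positivity) hx
  have hsimp : ∀ n : ℕ, lam * (S / n / lam) = (S : ℝ) / n := fun n => by field_simp
  have hdiv : Tendsto (fun n : ℕ => (S : ℝ) / n) atTop (𝓝 0) := tendsto_const_div_atTop_nhds_zero_nat _
  refine le_antisymm ?_ ?_
  · refine ge_of_tendsto (tendsto_rpow_gamma_ratio_pow (a := a)
      (u := fun n => b - x * Real.exp (-((S : ℝ) / n))) (v := fun _ => b - x)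
      (fun n => div_pos (hbxp _ (Real.exp_pos _)) hbx) (k := S * (x / (b - x))) ?_) ?_
    · refine ((tendsto_nat_mul_one_sub_exp S).mul_const (x / (b - x))).congr fun n => ?_
      field_simp
      ring
    · filter_upwards [eventually_ne_atTop 0] with n hn
      rw [hpow n hn]
      have h := (hnn n).1
      refine pow_le_pow_left₀ mgf_nonneg ?_ n
      rwa [hsimp] at h ⊢
  · refine le_of_tendsto (tendsto_rpow_gamma_ratio_pow (a := a)
      (u := fun _ => b - x) (v := fun n => b - x * Real.exp ((S : ℝ) / n))
      (fun n => div_pos hbx (hbxp _ (Real.exp_pos _))) (k := S * (x / (b - x))) ?_) ?_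
    · have h1 := (tendsto_nat_mul_one_sub_exp (-S)).neg
      have h2 : Tendsto (fun n : ℕ => x / (b - x * Real.exp ((S : ℝ) / n))) atTop
          (𝓝 (x / (b - x))) := by
        have : ContinuousAt (fun y : ℝ => x / (b - x * Real.exp y)) 0 :=
          ContinuousAt.div (by fun_prop) (by fun_prop) (by simpa using hbx.ne')
        simpa [Function.comp_def] using this.tendsto.comp hdiv
      have h3 := h1.mul h2
      rw [neg_neg] at h3
      refine h3.congr fun n => ?_
      have := (hbxp _ (Real.exp_pos ((S : ℝ) / n))).ne'
      rw [neg_div, neg_neg]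
      generalize Real.exp ((S : ℝ) / n) = E at *
      rw [div_sub_one this]
      ring
    · filter_upwards [eventually_ne_atTop 0] with n hn
      rw [hpow n hn]
      have h := (hnn n).2
      refine pow_le_pow_left₀ (Real.rpow_nonneg (div_pos hbx (hbxp _ (Real.exp_pos _))).le _) ?_ n
      rwa [hsimp] at h ⊢

end Stationary

/-! ### The polynomial families: existence, nonnegativity, evaluation -/

section Polynomials

open MvPolynomial

/-- The polynomials with nonnegative coefficients. -/
def nonnegCoeffs (σ : Type*) : Subsemiring (MvPolynomial σ ℝ) where
  carrier := {p | ∀ m, 0 ≤ p.coeff m}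
  mul_mem' {p q} hp hq m := by
    classical
    rw [coeff_mul]
    exact Finset.sum_nonneg fun x _ => mul_nonneg (hp _) (hq _)
  one_mem' m := by
    classical
    rw [coeff_one]
    split_ifs <;> norm_num
  add_mem' {p q} hp hq m := by
    rw [coeff_add]
    exact add_nonneg (hp m) (hq m)
  zero_mem' m := by simp

lemma C_mem_nonnegCoeffs {σ : Type*} {r : ℝ} (hr : 0 ≤ r) : C r ∈ nonnegCoeffs σ := fun m => by
  classical
  rw [coeff_C]
  split_ifs
  · exact hr
  · exact le_rfl

lemma X_mem_nonnegCoeffs {σ : Type*} (i : σ) : X i ∈ nonnegCoeffs σ := fun m => by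
  classical
  rw [coeff_X]
  split_ifs <;> norm_num

/-- The polynomials bounding the centred moments of the integrated variance. -/
noncomputable def momentPolyF : ℕ → MvPolynomial (Fin 3) ℝ
  | 0 => 0
  | 1 => 0
  | M + 2 =>
    X 0 * X 2 * momentPolyF (M + 1)
      -- `attach` supplies `1 ≤ i`, so that the index `M + 2 - i` decreases.
      + ∑ i ∈ (Finset.Icc 1 M).attach,
          C ((i : ℕ) * ((M + 1).factorial : ℝ) / ((M + 2 - i.1).factorial : ℝ))
            * X 0 * X 1 ^ (i.1 - 1) * X 2 * momentPolyF (M + 2 - i.1)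
      + C ((M + 2).factorial : ℝ) * X 1 ^ M
  decreasing_by
    · omega
    · have := Finset.mem_Icc.1 i.2
      omega

/-- The polynomials bounding the moments `momentG`. -/
noncomputable def momentPolyG : ℕ → MvPolynomial (Fin 5) ℝ
  | 0 => 0
  | 1 => C (1 / 2) * X 4 + C (3 / 2)
  | M + 2 =>
    (C (1 / 2) * X 4 + C (1 / 2)) * X 0 * X 3 * X 1 * X 2 * momentPolyG (M + 1)
      + ∑ i ∈ (Finset.Icc 1 (M + 1)).attach,
          C ((i : ℕ) * ((M + 1).factorial : ℝ) / ((M + 2 - i.1).factorial : ℝ))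
            * X 0 * X 1 * X 2 * X 3 ^ i.1 * momentPolyG (M + 2 - i.1)
      + C ((M + 2).factorial : ℝ) * X 3 ^ (M + 1)
  decreasing_by
    · omega
    · have := Finset.mem_Icc.1 i.2
      omega

lemma isMomentFamilyF_momentPolyF : IsMomentFamilyF momentPolyF := by
  refine ⟨by rw [momentPolyF], fun N hN => ?_⟩
  obtain ⟨M, rfl⟩ := Nat.exists_eq_add_of_le' hN
  rw [momentPolyF]
  congr 2
  exact Finset.sum_attach (Finset.Icc 1 M) fun i =>
    C ((i : ℕ) * ((M + 1).factorial : ℝ) / ((M + 2 - i).factorial : ℝ))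
      * X 0 * X 1 ^ (i - 1) * X 2 * momentPolyF (M + 2 - i)

lemma isMomentFamilyG_momentPolyG : IsMomentFamilyG momentPolyG := by
  refine ⟨by rw [momentPolyG], fun N hN => ?_⟩
  obtain ⟨M, rfl⟩ := Nat.exists_eq_add_of_le' hN
  rw [momentPolyG]
  congr 2
  exact Finset.sum_attach (Finset.Icc 1 (M + 1)) fun i =>
    C ((i : ℕ) * ((M + 1).factorial : ℝ) / ((M + 2 - i).factorial : ℝ))
      * X 0 * X 1 * X 2 * X 3 ^ i * momentPolyG (M + 2 - i)

lemma IsMomentFamilyF.mem_nonnegCoeffs {f : ℕ → MvPolynomial (Fin 3) ℝ} (hf : IsMomentFamilyF f)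
    {N : ℕ} (hN : 1 ≤ N) : f N ∈ nonnegCoeffs (Fin 3) := by
  induction N using Nat.strong_induction_on with
  | _ N ih =>
  obtain ⟨M, rfl⟩ := Nat.exists_eq_add_of_le' hN
  obtain rfl | hM := M.eq_zero_or_pos
  · rw [hf.1]
    exact zero_mem _
  rw [hf.2 M hM]
  have hX := X_mem_nonnegCoeffs (σ := Fin 3)
  refine add_mem (add_mem (mul_mem (mul_mem (hX _) (hX _)) (ih M (by omega) hM))
    (sum_mem fun i hi => ?_)) (mul_mem (C_mem_nonnegCoeffs (by positivity)) (pow_mem (hX _) _))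
  have := Finset.mem_Icc.1 hi
  exact mul_mem (mul_mem (mul_mem (mul_mem (C_mem_nonnegCoeffs (by positivity)) (hX _))
    (pow_mem (hX _) _)) (hX _)) (ih _ (by omega) (by omega))

lemma IsMomentFamilyG.mem_nonnegCoeffs {g : ℕ → MvPolynomial (Fin 5) ℝ} (hg : IsMomentFamilyG g)
    {N : ℕ} (hN : 1 ≤ N) : g N ∈ nonnegCoeffs (Fin 5) := by
  have hX := X_mem_nonnegCoeffs (σ := Fin 5)
  have hC : ∀ r : ℝ, 0 ≤ r → C r ∈ nonnegCoeffs (Fin 5) := fun r hr => C_mem_nonnegCoeffs hr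
  induction N using Nat.strong_induction_on with
  | _ N ih =>
  obtain ⟨M, rfl⟩ := Nat.exists_eq_add_of_le' hN
  obtain rfl | hM := M.eq_zero_or_pos
  · rw [hg.1]
    exact add_mem (mul_mem (hC _ (by norm_num)) (hX _)) (hC _ (by norm_num))
  rw [hg.2 M hM]
  refine add_mem (add_mem (mul_mem (mul_mem (mul_mem (mul_mem (mul_mem
    (add_mem (mul_mem (hC _ (by norm_num)) (hX _)) (hC _ (by norm_num))) (hX _)) (hX _)) (hX _))
    (hX _)) (ih M (by omega) hM))
    (sum_mem fun i hi => ?_)) (mul_mem (hC _ (by positivity)) (pow_mem (hX _) _))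
  have := Finset.mem_Icc.1 hi
  exact mul_mem (mul_mem (mul_mem (mul_mem (mul_mem (hC _ (by positivity)) (hX _))
    (hX _)) (hX _)) (pow_mem (hX _) _)) (ih _ (by omega) (by omega))

lemma sum_Icc_one_eq_sum_range (t : ℕ → ℝ) (M : ℕ) :
    ∑ i ∈ Finset.Icc 1 M, t i = ∑ i ∈ Finset.range M, t (i + 1) := by
  rw [Finset.range_eq_Ico, Finset.sum_Ico_add' t 0 M 1]
  rfl

/-- After the shift `i ↦ i + 1` the coefficients become a binomial times `(i + 1)!`, matching the
moment-cumulant recursion for exponential jumps. -/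
lemma succ_mul_factorial_div {N i : ℕ} (hi : i ≤ N) :
    ((i + 1 : ℕ) : ℝ) * (N.factorial : ℝ) / ((N + 1 - (i + 1)).factorial : ℝ)
      = (N.choose i : ℝ) * ((i + 1).factorial : ℝ) := by
  rw [Nat.add_sub_add_right, ← Nat.choose_mul_factorial_mul_factorial hi, Nat.factorial_succ]
  push_cast
  have : ((N - i).factorial : ℝ) ≠ 0 := by positivity
  field_simp

lemma IsMomentFamilyF.eval_add_two {f : ℕ → MvPolynomial (Fin 3) ℝ} (hf : IsMomentFamilyF f)
    (x y t : ℝ) (M : ℕ) :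
    eval ![x, y, t] (f (M + 2)) = x * t * eval ![x, y, t] (f (M + 1))
      + ∑ i ∈ Finset.range M, ((M + 1).choose i : ℝ) * ((i + 1).factorial : ℝ) * x * y ^ i * t
          * eval ![x, y, t] (f (M + 1 - i))
      + ((M + 2).factorial : ℝ) * y ^ M := by
  rw [hf.2 (M + 1) (by omega)]
  simp only [map_add, map_mul, map_sum, map_pow, eval_C, eval_X, Nat.add_sub_cancel]
  rw [sum_Icc_one_eq_sum_range]
  congr 2
  refine Finset.sum_congr rfl fun i hi => ?_
  have := Finset.mem_range.1 hi
  rw [succ_mul_factorial_div (by omega)]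
  simp

lemma IsMomentFamilyG.eval_add_two {g : ℕ → MvPolynomial (Fin 5) ℝ} (hg : IsMomentFamilyG g)
    (x₀ x₁ x₂ x₃ x₄ : ℝ) (M : ℕ) :
    eval ![x₀, x₁, x₂, x₃, x₄] (g (M + 2))
      = (1 / 2 * x₄ + 1 / 2) * x₀ * x₃ * x₁ * x₂ * eval ![x₀, x₁, x₂, x₃, x₄] (g (M + 1))
      + ∑ i ∈ Finset.range (M + 1), ((M + 1).choose i : ℝ) * ((i + 1).factorial : ℝ)
          * x₀ * x₁ * x₂ * x₃ ^ (i + 1) * eval ![x₀, x₁, x₂, x₃, x₄] (g (M + 1 - i))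
      + ((M + 2).factorial : ℝ) * x₃ ^ (M + 1) := by
  rw [hg.2 (M + 1) (by omega)]
  simp only [map_add, map_mul, map_sum, map_pow, eval_C, eval_X]
  rw [sum_Icc_one_eq_sum_range]
  congr 2
  refine Finset.sum_congr rfl fun i hi => ?_
  have := Finset.mem_range.1 hi
  rw [succ_mul_factorial_div (by omega)]
  simp

end Polynomials

/-! ### Comparison of the moment and polynomial recursions -/

section Recursions

/-- Here `κ i` is the cumulant of order `i + 1`. Induction applies the triangle inequality to the
moment recursion; the powers of `b` and `lam` combine to the common prefactor. -/
lemma abs_centred_moment_le {a b lam T : ℝ} (ha : 0 < a) (hb : 0 < b) (hlam : 0 < lam)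
    (hT : 0 < T) {m κ F : ℕ → ℝ} (hm0 : m 0 = 1) (hm1 : m 1 = 0)
    (hκ : ∀ i, 1 ≤ i → |κ i| ≤ a * (lam * T) * (((i + 1).factorial : ℝ) / (lam * b) ^ (i + 1)))
    (hrec : ∀ N, m (N + 1) = ∑ i ∈ Finset.range (N + 1), (N.choose i : ℝ) * κ i * m (N - i))
    (hF : ∀ M, F (M + 2) = a * T * F (M + 1)
      + ∑ i ∈ Finset.range M, ((M + 1).choose i : ℝ) * ((i + 1).factorial : ℝ) * a
          * (1 / lam) ^ i * T * F (M + 1 - i)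
      + ((M + 2).factorial : ℝ) * (1 / lam) ^ M) (hF1 : F 1 = 0) {N : ℕ} (hN : 1 ≤ N) :
    |m N| ≤ a * T / (lam * b ^ N) * F N := by
  have hκ0 : κ 0 = 0 := by
    have := hrec 0
    simpa [hm0, hm1, eq_comm] using this
  have hκ' : ∀ i, |κ i| ≤ a * (lam * T) * (((i + 1).factorial : ℝ) / (lam * b) ^ (i + 1)) :=
    fun i => by
      obtain rfl | hi := i.eq_zero_or_pos
      · rw [hκ0, abs_zero]
        positivity
      · exact hκ i hi
  induction N using Nat.strong_induction_on with
  | _ N ih =>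
  obtain ⟨M, rfl⟩ := Nat.exists_eq_add_of_le' hN
  obtain _ | M := M
  · simp [hm1, hF1]
  have hterm : ∀ i ∈ Finset.range M, |((M + 1).choose i : ℝ) * κ i * m (M + 1 - i)|
      ≤ a * T / (lam * b ^ (M + 2)) * (((M + 1).choose i : ℝ) * ((i + 1).factorial : ℝ) * a
          * (1 / lam) ^ i * T * F (M + 1 - i)) := fun i hi => by
    have hi' := Finset.mem_range.1 hi
    have h1 := ih (M + 1 - i) (by omega) (by omega)
    rw [abs_mul, abs_mul, Nat.abs_cast, mul_assoc]
    refine (mul_le_mul_of_nonneg_left (mul_le_mul (hκ' i) h1 (abs_nonneg _) (by positivity))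
      (Nat.cast_nonneg _)).trans_eq ?_
    have hpow : b ^ (M + 2) = b ^ (i + 1) * b ^ (M + 1 - i) := by
      rw [← pow_add]
      congr 1
      omega
    rw [hpow, mul_pow, one_div, inv_pow, pow_succ lam]
    field_simp
  have hlast : |κ (M + 1)|
      ≤ a * T / (lam * b ^ (M + 2)) * (((M + 2).factorial : ℝ) * (1 / lam) ^ M) := by
    refine (hκ (M + 1) (by omega)).trans_eq ?_
    rw [mul_pow, one_div, inv_pow, pow_add lam M (1 + 1)]
    field_simp
  -- The term `a * T * F (M + 1)` is slack in the polynomial recursion; its nonnegativity follows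
  -- from the induction hypothesis.
  have hfirst : 0 ≤ a * T / (lam * b ^ (M + 2)) * (a * T * F (M + 1)) := by
    have h1 : 0 ≤ a * T / (lam * b ^ (M + 1)) * F (M + 1) :=
      (abs_nonneg _).trans (ih (M + 1) (by omega) (by omega))
    have h2 : 0 ≤ F (M + 1) := nonneg_of_mul_nonneg_right h1 (by positivity)
    positivity
  have hz : M + 1 - M = 1 := by omega
  -- The two top terms are split off: one carries `m 1 = 0`, the other is `κ (M + 1)` because `m 0 =
  -- 1`.
  rw [hrec (M + 1), Finset.sum_range_succ, Finset.sum_range_succ, hz, hm1, mul_zero, add_zero,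
    Nat.sub_self, hm0, mul_one, Nat.choose_self, Nat.cast_one, one_mul, hF M, mul_add, mul_add,
    Finset.mul_sum]
  refine (abs_add_le _ _).trans (add_le_add ?_ hlast)
  refine ((Finset.abs_sum_le_sum_abs _ _).trans (Finset.sum_le_sum hterm)).trans ?_
  exact le_add_of_nonneg_left hfirst

/-- The shift `A` enters only the first cumulant and produces the leading term of the `G` recursion;
the jump cumulants `κ'` produce the remaining terms. All quantities are nonnegative, so the bounds
multiply. -/
lemma moment_le {a b S r E A : ℝ} (ha : 0 < a) (hb : 0 < b) (hS : 0 ≤ S) (hr : 0 ≤ r)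
    (hE : 0 ≤ E) (hA0 : 0 ≤ A) (hA : A ≤ a * S * r / b * (1 / 2 * E + 1 / 2))
    {m κ G : ℕ → ℝ} (hm0 : m 0 = 1)
    (hκ : ∀ i, κ i = (if i = 0 then A else 0)
      + a * S * (((i + 1).factorial : ℝ) * r ^ (i + 1) / b ^ (i + 1)))
    (hrec : ∀ N, m (N + 1) = ∑ i ∈ Finset.range (N + 1), (N.choose i : ℝ) * κ i * m (N - i))
    (hG : ∀ M, G (M + 2) = (1 / 2 * E + 1 / 2) * (a * S * r) * G (M + 1)
      + ∑ i ∈ Finset.range (M + 1), ((M + 1).choose i : ℝ) * ((i + 1).factorial : ℝ) * (a * S)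
          * r ^ (i + 1) * G (M + 1 - i)
      + ((M + 2).factorial : ℝ) * r ^ (M + 1)) (hG1 : G 1 = 1 / 2 * E + 3 / 2)
    {N : ℕ} (hN : 1 ≤ N) :
    0 ≤ m N ∧ m N ≤ a * S * r / b ^ N * G N := by
  set κ' : ℕ → ℝ := fun i => a * S * (((i + 1).factorial : ℝ) * r ^ (i + 1) / b ^ (i + 1)) with hκ'
  have hκ'0 : ∀ i, 0 ≤ κ' i := fun i => by positivity
  have hκ0 : ∀ i, 0 ≤ κ i := fun i => by
    rw [hκ]
    exact add_nonneg (by split_ifs <;> simp [hA0]) (hκ'0 i)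
  induction N using Nat.strong_induction_on with
  | _ N ih =>
  obtain ⟨M, rfl⟩ := Nat.exists_eq_add_of_le' hN
  have hnn : 0 ≤ m (M + 1) := by
    rw [hrec]
    refine Finset.sum_nonneg fun i _ => mul_nonneg (mul_nonneg (Nat.cast_nonneg _) (hκ0 i)) ?_
    obtain h | h := Nat.eq_zero_or_pos (M - i)
    · simp [h, hm0]
    · exact (ih (M - i) (by omega) h).1
  refine ⟨hnn, ?_⟩
  obtain _ | M := M
  · rw [hrec 0]
    simp only [zero_add, Finset.range_one, Finset.sum_singleton, Nat.choose_self, Nat.cast_one,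
      Nat.sub_self, hm0, hκ, if_true, Nat.factorial_one, pow_one, one_mul, mul_one, hG1]
    calc A + a * S * (r / b) ≤ a * S * r / b * (1 / 2 * E + 1 / 2) + a * S * (r / b) := by gcongr
      _ = _ := by ring
  have hsplit : m (M + 2) = A * m (M + 1)
      + ∑ i ∈ Finset.range (M + 1), ((M + 1).choose i : ℝ) * κ' i * m (M + 1 - i)
      + κ' (M + 1) := by
    rw [hrec (M + 1)]
    have h1 : κ' (M + 1) = ((M + 1).choose (M + 1) : ℝ) * κ' (M + 1) * m (M + 1 - (M + 1)) := by
      simp [hm0]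
    rw [h1, add_assoc (A * m (M + 1)),
      ← Finset.sum_range_succ (fun i => ((M + 1).choose i : ℝ) * κ' i * m (M + 1 - i))]
    simp_rw [hκ, mul_add, add_mul, Finset.sum_add_distrib]
    congr 1
    rw [Finset.sum_eq_single 0 (fun i _ hi => by simp [hi]) (by simp)]
    simp
  rw [hsplit, hG M, mul_add, mul_add, Finset.mul_sum]
  refine add_le_add (add_le_add ?_ (Finset.sum_le_sum fun i hi => ?_)) (le_of_eq ?_)
  · refine (mul_le_mul hA (ih (M + 1) (by omega) (by omega)).2
      (ih (M + 1) (by omega) (by omega)).1 (by positivity)).trans_eq ?_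
    rw [pow_succ b (M + 1)]
    field_simp
  · have hi' := Finset.mem_range.1 hi
    refine (mul_le_mul_of_nonneg_left (ih (M + 1 - i) (by omega) (by omega)).2
      (mul_nonneg (Nat.cast_nonneg _) (hκ'0 i))).trans_eq ?_
    have hpow : b ^ (M + 1 + 1) = b ^ (i + 1) * b ^ (M + 1 - i) := by
      rw [← pow_add]
      congr 1
      omega
    rw [hpow]
    simp only [hκ']
    field_simp
  · simp only [hκ']
    rw [pow_succ r (M + 1)]
    ring

end Recursions

/-! ### Application to the integrated variance and to `momentG` -/

section GammaOU

variable {Ω : Type*} [MeasurableSpace Ω] {Q : Measure Ω} {Z : ℝ≥0 → Ω → ℝ}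

lemma integrable_affine_pow {U : Ω → ℝ} [IsFiniteMeasure Q]
    (hU : ∀ k : ℕ, Integrable (fun ω => U ω ^ k) Q) (α β : ℝ) (N : ℕ) :
    Integrable (fun ω => (α * U ω + β) ^ N) Q := by
  simp_rw [add_pow, mul_pow]
  exact integrable_finsetSum _ fun i _ => (((hU i).const_mul _).mul_const _).mul_const _

lemma IsSubordinator.ae_increment_nonneg (hZ : IsSubordinator Q Z) (S : ℝ≥0) :
    ∀ᵐ ω ∂Q, 0 ≤ Z S ω - Z 0 ω := by
  filter_upwards [hZ.monotone] with ω hω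
  simpa using hω (zero_le : 0 ≤ S)

lemma IsSubordinator.measurable_increment (hZ : IsSubordinator Q Z) (S : ℝ≥0) :
    Measurable fun ω => Z S ω - Z 0 ω := (hZ.measurable S).sub (hZ.measurable 0)

lemma integrable_increment_pow [IsProbabilityMeasure Q] (hZ : IsSubordinator Q Z)
    {lam a b : ℝ} (hlam : 0 < lam) (ha : 0 < a) (hb : 0 < b)
    (hst : IsOUStationaryDistribution Q lam Z (gammaMeasure a b)) (S : ℝ≥0) (k : ℕ) :
    Integrable (fun ω => (Z S ω - Z 0 ω) ^ k) Q := by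
  refine integrable_pow_of_mgf_eq (s := Finset.range 1) (c := fun _ => a * S) (w := fun _ => 1) hb
    (fun _ _ => by positivity) (fun _ _ => zero_le_one)
    (hZ.measurable_increment S).aemeasurable (hZ.ae_increment_nonneg S) (fun t ht => ?_) k
  rw [mgf_subordinator hZ hlam ha hb hst S ht.le]
  simp [mul_assoc]

/-- The Riemann-Stieltjes sums for the integrated variance. -/
noncomputable def ouSum (lam T : ℝ) (Z : ℝ≥0 → Ω → ℝ) (n : ℕ) (ω : Ω) : ℝ :=
  ∑ j ∈ Finset.range n, ouWeight lam T (j * (T / n))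
    * (Z ((j + 1 : ℕ) * (lam * T / n).toNNReal) ω - Z (j * (lam * T / n).toNNReal) ω)

lemma IsSubordinator.measurable_ouSum (hZ : IsSubordinator Q Z) (lam T : ℝ) (n : ℕ) :
    Measurable (ouSum lam T Z n) :=
  Finset.measurable_fun_sum _ fun _ _ =>
    ((hZ.measurable _).sub (hZ.measurable _)).const_mul _

lemma natCast_mul_div_le {T : ℝ} (hT : 0 ≤ T) {j n : ℕ} (h : j ≤ n) : (j : ℝ) * (T / n) ≤ T := by
  obtain rfl | hn := n.eq_zero_or_pos
  · simpa using hT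
  have : (j : ℝ) ≤ n := by exact_mod_cast h
  have hn' : (0 : ℝ) < n := by exact_mod_cast hn
  calc (j : ℝ) * (T / n) ≤ n * (T / n) := by gcongr
    _ = T := by field_simp

lemma natCast_mul_toNNReal_div {lam T : ℝ} {n : ℕ} (hn : n ≠ 0) :
    (n : ℝ≥0) * (lam * T / n).toNNReal = (lam * T).toNNReal := by
  rw [← Real.toNNReal_natCast, ← Real.toNNReal_mul (Nat.cast_nonneg n)]
  congr 1
  field_simp

lemma IsSubordinator.ae_ouSum_mem (hZ : IsSubordinator Q Z) {lam T : ℝ} (hlam : 0 < lam)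
    (hT : 0 ≤ T) {n : ℕ} (hn : n ≠ 0) :
    ∀ᵐ ω ∂Q, 0 ≤ ouSum lam T Z n ω ∧
      ouSum lam T Z n ω ≤ 1 / lam * (Z (lam * T).toNNReal ω - Z 0 ω) := by
  filter_upwards [hZ.monotone] with ω hω
  set h := (lam * T / n).toNNReal
  have hinc : ∀ j : ℕ, 0 ≤ Z ((j + 1 : ℕ) * h) ω - Z (j * h) ω := fun j =>
    sub_nonneg.2 (hω (by gcongr; simp))
  constructor
  · exact Finset.sum_nonneg fun j hj => mul_nonneg (ouWeight_nonneg hlam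
      (natCast_mul_div_le hT (Finset.mem_range.1 hj).le)) (hinc j)
  · calc ouSum lam T Z n ω
        ≤ ∑ j ∈ Finset.range n, 1 / lam * (Z ((j + 1 : ℕ) * h) ω - Z (j * h) ω) :=
          Finset.sum_le_sum fun j _ => mul_le_mul_of_nonneg_right (ouWeight_le hlam) (hinc j)
      _ = 1 / lam * (Z (lam * T).toNNReal ω - Z 0 ω) := by
          rw [← Finset.mul_sum, Finset.sum_range_sub (fun j => Z ((j : ℕ) * h) ω),
            natCast_mul_toNNReal_div hn]
          simp

lemma IsSubordinator.ae_tendsto_ouSum (hZ : IsSubordinator Q Z) {lam T : ℝ} (hlam : 0 < lam)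
    (hT : 0 ≤ T) :
    ∀ᵐ ω ∂Q, Tendsto (fun n => ouSum lam T Z n ω) atTop
      (𝓝 (∫ s in (0 : ℝ)..T, Real.exp (-(lam * (T - s)))
        * (Z (lam * s).toNNReal ω - Z 0 ω))) := by
  filter_upwards [hZ.ae_path hlam] with ω hω
  have hlim : Tendsto (fun n : ℕ => T / n * (Z (lam * T).toNNReal ω - Z 0 ω)) atTop (𝓝 0) := by
    simpa using (tendsto_const_div_atTop_nhds_zero_nat T).mul_const
      (Z (lam * T).toNNReal ω - Z 0 ω)
  rw [tendsto_iff_norm_sub_tendsto_zero]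
  refine squeeze_zero' (Eventually.of_forall fun _ => norm_nonneg _) ?_ hlim
  filter_upwards [eventually_ne_atTop 0] with n hn
  have h := abs_integral_exp_ou_mul_sub_sum_le hlam hT hω.1 (by simp) hn
  rw [norm_sub_rev, Real.norm_eq_abs]
  convert h using 3
  refine Finset.sum_congr rfl fun j _ => ?_
  have e : ∀ k : ℕ, (lam * (k * (T / n))).toNNReal = k * (lam * T / n).toNNReal := fun k => by
    rw [← Real.toNNReal_natCast, ← Real.toNNReal_mul (Nat.cast_nonneg k)]
    congr 1
    ring
  rw [e, e]
  ring

lemma mgf_ouSum [IsProbabilityMeasure Q] (hZ : IsSubordinator Q Z)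
    {lam a b : ℝ} (hlam : 0 < lam) (ha : 0 < a) (hb : 0 < b)
    (hst : IsOUStationaryDistribution Q lam Z (gammaMeasure a b)) {T : ℝ} (hT : 0 ≤ T) (n : ℕ)
    {x : ℝ} (hx : x < 0) :
    mgf (ouSum lam T Z n) Q x = Real.exp (∑ j ∈ Finset.range n, a * (lam * T / n)
      * (x * ouWeight lam T (j * (T / n)) / (b - x * ouWeight lam T (j * (T / n))))) := by
  have h := hZ.mgf_sum_increments (lam * T / n).toNNReal
    (fun j => ouWeight lam T (j * (T / n))) n x
  refine h.trans ?_
  rw [Real.exp_sum]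
  refine Finset.prod_congr rfl fun j hj => ?_
  have hw := ouWeight_nonneg hlam (natCast_mul_div_le hT (Finset.mem_range.1 hj).le)
  rw [mgf_subordinator hZ hlam ha hb hst _ (mul_nonpos_of_nonneg_of_nonpos hw hx.le),
    Real.coe_toNNReal _ (by positivity), mul_comm x, mul_assoc]

/-- There are `n` summands of intensity `a * lam * T / n` with weights at most `1 / lam`, so the
cumulant bounds, and hence the moment bound, do not depend on `n`. Centring makes the first cumulant
vanish. -/
lemma abs_centred_moment_ouSum_le [IsProbabilityMeasure Q] (hZ : IsSubordinator Q Z)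
    {lam a b : ℝ} (hlam : 0 < lam) (ha : 0 < a) (hb : 0 < b)
    (hst : IsOUStationaryDistribution Q lam Z (gammaMeasure a b)) {T : ℝ} (hT : 0 < T) {n : ℕ}
    (hn : n ≠ 0) {f : ℕ → MvPolynomial (Fin 3) ℝ} (hf : IsMomentFamilyF f) {N : ℕ} (hN : 1 ≤ N) :
    |∫ ω, (ouSum lam T Z n ω - ∫ ω', ouSum lam T Z n ω' ∂Q) ^ N ∂Q|
      ≤ a * T / (lam * b ^ N) * MvPolynomial.eval ![a, 1 / lam, T] (f N) := by
  set X := ouSum lam T Z n with hX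
  set μ := ∫ ω', X ω' ∂Q with hμ
  set w : ℕ → ℝ := fun j => ouWeight lam T (j * (T / n)) with hw
  have hn' : (0 : ℝ) < n := by positivity
  have hw0 : ∀ j ∈ Finset.range n, 0 ≤ w j := fun j hj =>
    ouWeight_nonneg hlam (natCast_mul_div_le hT.le (Finset.mem_range.1 hj).le)
  have hXm : AEMeasurable X Q := (hZ.measurable_ouSum lam T n).aemeasurable
  have hX0 : ∀ᵐ ω ∂Q, 0 ≤ X ω := by
    filter_upwards [hZ.ae_ouSum_mem hlam hT.le hn] with ω hω using hω.1
  have hXi : ∀ k : ℕ, Integrable (fun ω => X ω ^ k) Q :=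
    integrable_pow_of_mgf_eq hb (c := fun _ => a * (lam * T / n)) (w := w)
      (fun _ _ => by positivity) hw0 hXm hX0 fun x hx => mgf_ouSum hZ hlam ha hb hst hT.le n hx
  have hVi : ∀ k : ℕ, Integrable (fun ω => (X ω - μ) ^ k) Q := fun k => by
    simpa [sub_eq_add_neg] using integrable_affine_pow hXi 1 (-μ) k
  have hrec := moment_succ_of_mgf_eq (V := fun ω => X ω - μ) (d := -μ) (D := μ)
    (c := fun _ => a * (lam * T / n)) (w := w) (s := Finset.range n) hb hw0 (hXm.sub_const μ)
    (by filter_upwards [hX0] with ω hω; linarith) hVi (fun x hx => by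
      simp_rw [sub_eq_add_neg _ μ]
      rw [mgf_add_const, mgf_ouSum hZ hlam ha hb hst hT.le n hx, ← Real.exp_add, add_comm,
        mul_comm x])
  refine abs_centred_moment_le ha hb hlam hT (m := fun N => ∫ ω, (X ω - μ) ^ N ∂Q)
    (F := fun N => MvPolynomial.eval ![a, 1 / lam, T] (f N)) (by simp) ?_ (fun i hi => ?_) hrec
    (fun M => hf.eval_add_two a (1 / lam) T M) (by simp [hf.1]) hN
  · simp only [pow_one]
    rw [integral_sub (by simpa using hXi 1) (integrable_const _)]
    simp [hμ]
  · rw [cumulantDeriv_zero_eq hb, if_neg (by omega), zero_add]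
    rw [abs_of_nonneg (Finset.sum_nonneg fun j hj => by have := hw0 j hj; positivity)]
    calc ∑ j ∈ Finset.range n,
          a * (lam * T / n) * (((i + 1).factorial : ℝ) * w j ^ (i + 1) / b ^ (i + 1))
        ≤ ∑ j ∈ Finset.range n,
          a * (lam * T / n) * (((i + 1).factorial : ℝ) * (1 / lam) ^ (i + 1) / b ^ (i + 1)) := by
          refine Finset.sum_le_sum fun j hj => ?_
          have h1 := hw0 j hj
          have h2 : w j ≤ 1 / lam := ouWeight_le hlam
          gcongr
      _ = a * (lam * T) * (((i + 1).factorial : ℝ) / (lam * b) ^ (i + 1)) := by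
          rw [Finset.sum_const, Finset.card_range, nsmul_eq_mul, mul_pow, one_div, inv_pow]
          field_simp

/-- The centred moments of the integrated variance. -/
lemma IsGammaOU.centred_moment_le [IsProbabilityMeasure Q] {lam a b σ2₀ : ℝ}
    {σ2 : ℝ → Ω → ℝ} (hlam : 0 < lam) (ha : 0 < a) (hb : 0 < b)
    (hσ : IsGammaOU Q lam a b σ2₀ Z σ2) {T : ℝ} (hT : 0 < T)
    {f : ℕ → MvPolynomial (Fin 3) ℝ} (hf : IsMomentFamilyF f) {N : ℕ} (hN : 1 ≤ N) :
    Integrable (integratedVariance σ2 T) Q ∧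
      Integrable (fun ω => (integratedVariance σ2 T ω
        - ∫ ω', integratedVariance σ2 T ω' ∂Q) ^ N) Q ∧
      |∫ ω, (integratedVariance σ2 T ω - ∫ ω', integratedVariance σ2 T ω' ∂Q) ^ N ∂Q|
        ≤ a * T / (lam * b ^ N) * MvPolynomial.eval ![a, 1 / lam, T] (f N) := by
  have hZ := hσ.subordinator
  set U : Ω → ℝ := fun ω => Z (lam * T).toNNReal ω - Z 0 ω with hU
  set X : Ω → ℝ := fun ω => ∫ s in (0 : ℝ)..T, Real.exp (-(lam * (T - s)))
    * (Z (lam * s).toNNReal ω - Z 0 ω) with hX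
  set A : ℝ := σ2₀ * ouWeight lam T 0
  have hUi : ∀ k : ℕ, Integrable (fun ω => U ω ^ k) Q :=
    integrable_increment_pow hZ hlam ha hb hσ.stationary _
  have hU0 : ∀ᵐ ω ∂Q, 0 ≤ U ω := hZ.ae_increment_nonneg _
  have hlim : ∀ᵐ ω ∂Q, Tendsto (fun n => ouSum lam T Z (n + 1) ω) atTop (𝓝 (X ω)) := by
    filter_upwards [hZ.ae_tendsto_ouSum hlam hT.le] with ω hω using
      (tendsto_add_atTop_iff_nat 1).2 hω
  have hmem : ∀ᵐ ω ∂Q, ∀ n : ℕ, 0 ≤ ouSum lam T Z (n + 1) ω ∧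
      ouSum lam T Z (n + 1) ω ≤ 1 / lam * U ω :=
    ae_all_iff.2 fun n => hZ.ae_ouSum_mem hlam hT.le n.succ_ne_zero
  have hsm : ∀ n : ℕ, AEStronglyMeasurable (ouSum lam T Z (n + 1)) Q := fun n =>
    (hZ.measurable_ouSum lam T _).aestronglyMeasurable
  have hbdU : Integrable (fun ω => 1 / lam * U ω) Q := by
    simpa using (hUi 1).const_mul (1 / lam)
  have hXm : AEStronglyMeasurable X Q := aestronglyMeasurable_of_tendsto_ae _ hsm hlim
  have hXmem : ∀ᵐ ω ∂Q, 0 ≤ X ω ∧ X ω ≤ 1 / lam * U ω := by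
    filter_upwards [hlim, hmem] with ω h1 h2
    exact ⟨ge_of_tendsto' h1 fun n => (h2 n).1, le_of_tendsto' h1 fun n => (h2 n).2⟩
  have hXi : Integrable X Q := hbdU.mono' hXm (by
    filter_upwards [hXmem] with ω hω
    rw [Real.norm_eq_abs, abs_of_nonneg hω.1]
    exact hω.2)
  -- The initial value contributes only the constant `A`, which cancels after centring.
  have hI : integratedVariance σ2 T =ᵐ[Q] fun ω => A + X ω := by
    filter_upwards [hσ.ou, hZ.ae_path hlam] with ω h1 h2
    exact integral_eq_of_ou' (Y := fun s => σ2 s ω) hlam hT.le h2.1 h2.2 h1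
  have hIint : ∫ ω, integratedVariance σ2 T ω ∂Q = A + ∫ ω, X ω ∂Q := by
    rw [integral_congr_ae hI, integral_add (integrable_const _) hXi]
    simp
  have hmean : Tendsto (fun n => ∫ ω, ouSum lam T Z (n + 1) ω ∂Q) atTop (𝓝 (∫ ω, X ω ∂Q)) := by
    refine tendsto_integral_of_dominated_convergence _ hsm hbdU (fun n => ?_) hlim
    filter_upwards [hmem] with ω hω
    rw [Real.norm_eq_abs, abs_of_nonneg (hω n).1]
    exact (hω n).2
  have hmean_mem : ∀ n : ℕ, 0 ≤ ∫ ω, ouSum lam T Z (n + 1) ω ∂Q ∧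
      ∫ ω, ouSum lam T Z (n + 1) ω ∂Q ≤ ∫ ω, 1 / lam * U ω ∂Q := fun n => by
    have h0 : 0 ≤ᵐ[Q] ouSum lam T Z (n + 1) := by
      filter_upwards [hmem] with ω hω using (hω n).1
    refine ⟨integral_nonneg_of_ae h0, integral_mono_of_nonneg h0 hbdU ?_⟩
    filter_upwards [hmem] with ω hω using (hω n).2
  set B : ℝ := ∫ ω, 1 / lam * U ω ∂Q
  -- Each sum lies in `[0, U / lam]` and its mean in `[0, B]`, so the centred sum has absolute value
  -- at most `U / lam + B`, with moments of all orders.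
  have hbdN : Integrable (fun ω => (1 / lam * U ω + B) ^ N) Q := integrable_affine_pow hUi _ _ N
  have hdom : ∀ n : ℕ, ∀ᵐ ω ∂Q,
      ‖(ouSum lam T Z (n + 1) ω - ∫ ω', ouSum lam T Z (n + 1) ω' ∂Q) ^ N‖
        ≤ (1 / lam * U ω + B) ^ N := fun n => by
    filter_upwards [hmem] with ω hω
    rw [norm_pow, Real.norm_eq_abs]
    refine pow_le_pow_left₀ (abs_nonneg _) (abs_le.2 ⟨?_, ?_⟩) N
    · linarith [(hω n).1, (hω n).2, (hmean_mem n).2]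
    · linarith [(hω n).1, (hω n).2, (hmean_mem n).1, (hmean_mem n).2]
  have hlimN : ∀ᵐ ω ∂Q, Tendsto
      (fun n => (ouSum lam T Z (n + 1) ω - ∫ ω', ouSum lam T Z (n + 1) ω' ∂Q) ^ N) atTop
      (𝓝 ((X ω - ∫ ω', X ω' ∂Q) ^ N)) := by
    filter_upwards [hlim] with ω hω using (hω.sub hmean).pow N
  have hcongr : (fun ω => (integratedVariance σ2 T ω
      - ∫ ω', integratedVariance σ2 T ω' ∂Q) ^ N)
      =ᵐ[Q] fun ω => (X ω - ∫ ω', X ω' ∂Q) ^ N := by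
    filter_upwards [hI] with ω hω
    rw [hω, hIint, add_sub_add_left_eq_sub]
  have hsmN : ∀ n : ℕ, AEStronglyMeasurable
      (fun ω => (ouSum lam T Z (n + 1) ω - ∫ ω', ouSum lam T Z (n + 1) ω' ∂Q) ^ N) Q :=
    fun n => ((hsm n).sub aestronglyMeasurable_const).pow N
  refine ⟨((integrable_const A).add hXi).congr hI.symm, Integrable.congr ?_ hcongr.symm, ?_⟩
  · refine hbdN.mono' (aestronglyMeasurable_of_tendsto_ae _ hsmN hlimN) ?_
    filter_upwards [hlimN, ae_all_iff.2 hdom] with ω h1 h2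
    exact le_of_tendsto' h1.norm h2
  · rw [integral_congr_ae hcongr]
    have h := tendsto_integral_of_dominated_convergence _ hsmN hbdN hdom hlimN
    exact le_of_tendsto' h.abs fun n =>
      abs_centred_moment_ouSum_le hZ hlam ha hb hσ.stationary hT n.succ_ne_zero hf hN

lemma IsGammaOU.kappa_eq [IsProbabilityMeasure Q] {lam a b σ2₀ : ℝ}
    {σ2 : ℝ → Ω → ℝ} (hlam : 0 < lam) (ha : 0 < a) (hb : 0 < b)
    (hσ : IsGammaOU Q lam a b σ2₀ Z σ2) {ρ : ℝ} (hρ : ρ ≤ 0) :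
    kappa Q Z ρ = a * (ρ / (b - ρ)) := by
  have h1 : mgf (Z 1) Q ρ = mgf (fun ω => Z 1 ω - Z 0 ω) Q ρ := by
    refine mgf_congr ?_
    filter_upwards [hσ.subordinator.zero] with ω hω
    rw [hω, sub_zero]
  rw [kappa, cgf, h1, mgf_subordinator hσ.subordinator hlam ha hb hσ.stationary 1 hρ, Real.log_exp]
  simp

/-- The moments `momentG`. -/
lemma IsGammaOU.momentG_le [IsProbabilityMeasure Q] {lam a b σ2₀ : ℝ}
    {σ2 : ℝ → Ω → ℝ} (hlam : 0 < lam) (ha : 0 < a) (hb : 0 < b)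
    (hσ : IsGammaOU Q lam a b σ2₀ Z σ2) {T : ℝ} (hT : 0 < T) {ρ : ℝ} (hρ : ρ ≤ 0)
    {g : ℕ → MvPolynomial (Fin 5) ℝ} (hg : IsMomentFamilyG g) {N : ℕ} (hN : 1 ≤ N) :
    Integrable (fun ω => boundVariable Q lam Z ρ T ω ^ N) Q ∧
      momentG Q lam Z ρ T N ≤ a * lam * T * |ρ| / b ^ N * MvPolynomial.eval
        ![a, lam, T, |ρ|, Real.exp (-(lam * T * kappa Q Z ρ))] (g N) := by
  have hZ := hσ.subordinator
  set E := Real.exp (-(lam * T * kappa Q Z ρ)) with hE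
  set A := -(lam * T * kappa Q Z ρ) * (1 / 2 * E + 1 / 2) with hA
  set U : Ω → ℝ := fun ω => Z (lam * T).toNNReal ω - Z 0 ω with hU
  set V : Ω → ℝ := fun ω => |ρ| * U ω + A with hV
  have hE0 : 0 < E := Real.exp_pos _
  have hbρ : b ≤ b - ρ := by linarith
  have hκ : -(lam * T * kappa Q Z ρ) = a * (lam * T) * (|ρ| / (b - ρ)) := by
    rw [hσ.kappa_eq hlam ha hb hρ, abs_of_nonpos hρ]
    ring
  have hA0 : 0 ≤ A := by
    rw [hA, hκ]
    have : 0 < b - ρ := hb.trans_le hbρ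
    positivity
  -- This replaces `b - ρ` by the smaller `b`, using `ρ ≤ 0`.
  have hAle : A ≤ a * (lam * T) * |ρ| / b * (1 / 2 * E + 1 / 2) := by
    rw [hA, hκ, mul_div_assoc]
    gcongr
  have hUi : ∀ k : ℕ, Integrable (fun ω => U ω ^ k) Q :=
    integrable_increment_pow hZ hlam ha hb hσ.stationary _
  have hVi : ∀ k : ℕ, Integrable (fun ω => V ω ^ k) Q := integrable_affine_pow hUi _ _
  have hUm : Measurable U := hZ.measurable_increment _
  have hcongr : ∀ N : ℕ, (fun ω => boundVariable Q lam Z ρ T ω ^ N) =ᵐ[Q] fun ω => V ω ^ N :=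
    fun N => by
      filter_upwards [hZ.zero] with ω hω
      simp only [boundVariable, hV, hU, hω, sub_zero]
      rw [add_comm]
  -- One compound Poisson term of weight `|ρ|` shifted by the drift `A`; no discretisation is
  -- needed.
  have hrec := moment_succ_of_mgf_eq (V := V) (d := A) (D := 0)
    (c := fun _ => a * (lam * T)) (w := fun _ => |ρ|) (s := Finset.range 1) hb
    (fun _ _ => abs_nonneg ρ) ((hUm.const_mul |ρ|).add_const A).aemeasurable
    (by
      filter_upwards [hZ.ae_increment_nonneg (lam * T).toNNReal] with ω hω
      rw [neg_zero]
      exact add_nonneg (mul_nonneg (abs_nonneg ρ) hω) hA0) hVi (fun x hx => by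
      rw [hV, mgf_add_const, mgf_const_mul, mgf_subordinator hZ hlam ha hb hσ.stationary _
        (mul_nonpos_of_nonneg_of_nonpos (abs_nonneg ρ) hx.le), ← Real.exp_add,
        Real.coe_toNNReal _ (by positivity), Finset.sum_range_one]
      congr 1
      ring)
  refine ⟨(hVi N).congr (hcongr N).symm, ?_⟩
  rw [momentG, integral_congr_ae (hcongr N), mul_assoc a lam T]
  refine (moment_le ha hb (by positivity) (abs_nonneg ρ) hE0.le hA0 hAle
    (m := fun N => ∫ ω, V ω ^ N ∂Q)
    (G := fun N => MvPolynomial.eval ![a, lam, T, |ρ|, E] (g N)) (by simp)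
    (fun i => ?_) hrec (fun M => ?_) ?_ hN).2
  · rw [cumulantDeriv_zero_eq hb, Finset.sum_range_one]
  · rw [hg.eval_add_two]
    congr 2
    · ring
    · refine Finset.sum_congr rfl fun i _ => ?_
      ring
  · simp [hg.1]

end GammaOU

/-! ### Main theorem -/

theorem mainTheorem8 :
    ∃ (f : ℕ → MvPolynomial (Fin 3) ℝ) (g : ℕ → MvPolynomial (Fin 5) ℝ),
      IsMomentFamilyF f ∧ IsMomentFamilyG g ∧
      (∀ N : ℕ, 1 ≤ N → ∀ m : Fin 3 →₀ ℕ, 0 ≤ (f N).coeff m) ∧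
      (∀ N : ℕ, 1 ≤ N → ∀ m : Fin 5 →₀ ℕ, 0 ≤ (g N).coeff m) ∧
      ∀ (Ω : Type*) [MeasurableSpace Ω] (Q : Measure Ω) [IsProbabilityMeasure Q]
        (lam a b σ2₀ : ℝ) (Z : ℝ≥0 → Ω → ℝ) (σ2 : ℝ → Ω → ℝ),
        0 < lam → 0 < a → 0 < b → 0 < σ2₀ → IsGammaOU Q lam a b σ2₀ Z σ2 →
        ∀ (T : ℝ), 0 < T → ∀ (N : ℕ), 1 ≤ N →
          (Integrable (integratedVariance σ2 T) Q ∧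
            Integrable (fun ω => (integratedVariance σ2 T ω
              - ∫ ω', integratedVariance σ2 T ω' ∂Q) ^ N) Q ∧
            |∫ ω, (integratedVariance σ2 T ω
                - ∫ ω', integratedVariance σ2 T ω' ∂Q) ^ N ∂Q|
              ≤ a * T / (lam * b ^ N) * MvPolynomial.eval ![a, 1 / lam, T] (f N)) ∧
          (∀ ρ : ℝ, ρ ≤ 0 →
            Integrable (fun ω => boundVariable Q lam Z ρ T ω ^ N) Q ∧
            momentG Q lam Z ρ T N
              ≤ a * lam * T * |ρ| / b ^ N
                * MvPolynomial.eval
                    ![a, lam, T, |ρ|, Real.exp (-(lam * T * kappa Q Z ρ))] (g N)) := by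
  refine ⟨momentPolyF, momentPolyG, isMomentFamilyF_momentPolyF, isMomentFamilyG_momentPolyG,
    fun N hN => isMomentFamilyF_momentPolyF.mem_nonnegCoeffs hN,
    fun N hN => isMomentFamilyG_momentPolyG.mem_nonnegCoeffs hN, ?_⟩
  intro Ω _ Q _ lam a b σ2₀ Z σ2 hlam ha hb _ hσ T hT N hN
  exact ⟨hσ.centred_moment_le hlam ha hb hT isMomentFamilyF_momentPolyF hN,
    fun ρ hρ => hσ.momentG_le hlam ha hb hT hρ isMomentFamilyG_momentPolyG hN⟩
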